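/- Let $n\ge 1$, let $\mathbb B^n=\{z\in\mathbb C^n:|z|<1\}$ be the Euclidean unit ball, let $m$ be normalized Lebesgue measure on $\mathbb B^n$, and write $z\bar w=\sum_{i=1}^n z_i\overline{w_i}$. For $0<p<\infty$ and $\alpha>-1/p$, the weighted Bergman space $B_\alpha^p$ consists of the holomorphic functions $f$ on $\mathbb B^n$ with $\int_{\mathbb B^n}(1-|z|^2)^{\alpha p}|f(z)|^p\,dm(z)<\infty$. A sequence $\{a_k\}_{k}\subset\mathbb B^n$ is called $B_\alpha^p$-interpolating if for every sequence $\{v_k\}_k\subset\mathbb C$ with $\sum_k\bigl[(1-|a_k|^2)^{\frac{n+1}p+\alpha}|v_k|\bigr]^p<\infty$ there is $f\in B_\alpha^p$ with $f(a_k)=v_k$ for all $k$. For $s,t>0$ put $$K(\{a_k\},s,t)=\sup_k\sum_{j:\,j\ne k}\frac{(1-|a_k|^2)^s(1-|a_j|^2)^t}{|1-\bar a_k a_j|^{s+t}}\in[0,\infty].$$ **Theorem 4.5.** Let $1<p<\infty$, let $q$ be its conjugate exponent, $\frac1p+\frac1q=1$, let $\alpha>-1/p$ and $\beta=\alpha p/q$,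 and let $\{a_k\}_k$ be a sequence in $\mathbb B^n$. If there exist $c_1,c_2>0$ with $c_1c_2<1$ such that $$K\Bigl(\{a_k\},\tfrac{n+1}p+\alpha,\tfrac{n+1}q+\beta\Bigr)\le c_1^q\quad\text{and}\quad K\Bigl(\{a_k\},\tfrac{n+1}q+\beta,\tfrac{n+1}p+\alpha\Bigr)\le c_2^p,$$ then $\{a_k\}_k$ is $B_\alpha^p$-interpolating. -/

import Mathlib

open MeasureTheory

/-- The open unit ball of `ℂⁿ` (Euclidean norm). -/
def unitBall (n : ℕ) : Set (EuclideanSpace ℂ (Fin n)) :=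
  Metric.ball 0 1

/-- Lebesgue measure on the unit ball of `ℂⁿ`, normalized to total mass one. -/
noncomputable def ballMeasure (n : ℕ) : Measure (EuclideanSpace ℂ (Fin n)) :=
  (volume (unitBall n))⁻¹ • volume.restrict (unitBall n)

/-- Membership in the weighted Bergman space `B_α^p` (for `0 < p < ∞` and `α > -1/p`): `f` is
holomorphic in the unit ball and `∫ (1 - |z|²)^(α p) |f(z)|^p dm(z) < ∞`. Only the values of `f` on
the ball matter. -/
def MemBergman (n : ℕ) (p α : ℝ) (f : EuclideanSpace ℂ (Fin n) → ℂ) : Prop :=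
  DifferentiableOn ℂ f (unitBall n) ∧
    ∫⁻ z, ENNReal.ofReal ((1 - ‖z‖ ^ 2) ^ (α * p) * ‖f z‖ ^ p) ∂(ballMeasure n) < ⊤

/-- Membership in the weighted sequence space `ℓ_β^p(a)`: the sequence `(1 - |a_k|²)^β v_k` is
`p`-summable. -/
def MemWeightedLp {n : ℕ} (p β : ℝ) (a : ℕ → EuclideanSpace ℂ (Fin n)) (v : ℕ → ℂ) : Prop :=
  Summable fun k => ((1 - ‖a k‖ ^ 2) ^ β * ‖v k‖) ^ p

/-- The sequence `a` is interpolating for `B_α^p`: all data in `ℓ_{(n+1)/p+α}^p(a)` are the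
values along `a` of some function in `B_α^p`. -/
def IsBergmanInterpolating {n : ℕ} (p α : ℝ) (a : ℕ → EuclideanSpace ℂ (Fin n)) : Prop :=
  ∀ v : ℕ → ℂ, MemWeightedLp p (((n : ℝ) + 1) / p + α) a v →
    ∃ f : EuclideanSpace ℂ (Fin n) → ℂ, MemBergman n p α f ∧ ∀ k, f (a k) = v k

/-- `K(a, s, t) = sup_k ∑_{j ≠ k} (1 - |a_k|²)^s (1 - |a_j|²)^t / |1 - ⟨a_j, a_k⟩|^(s+t)`, with
values in `[0, ∞]`. -/
noncomputable def bergmanK {n : ℕ} (a : ℕ → EuclideanSpace ℂ (Fin n)) (s t : ℝ) : ENNReal :=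
  ⨆ k : ℕ, ∑' j : {j : ℕ // j ≠ k},
    ENNReal.ofReal ((1 - ‖a k‖ ^ 2) ^ s * (1 - ‖a j‖ ^ 2) ^ t /
      ‖1 - inner ℂ (a k) (a j)‖ ^ (s + t))

/-! Put N = n + 1 + αp, s = N/p and t = N - s. The hypotheses on α and β say precisely that s and t
are the two exponents appearing in K, and that s + t = N. The interpolating function is sought as
f(z) = ∑ u_j (1-|a_j|²)^t (1-⟨a_j,z⟩)^(-N); `inner ℂ` is linear in its second slot, so each term is
holomorphic in z. Multiplying f(a_k) = v_k by (1-|a_k|²)^s gives (I + M)u = v', where v' lies in ℓ^p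
and M has zero diagonal. The two bounds on K control the row and column sums of |M|, and Schur's
test (`ENNReal.tsum_tsum_mul_rpow_le`) gives ‖M‖ ≤ c₁c₂ < 1. Hence I + M is invertible on ℓ^p
(`exists_add_tsum_mul_eq`).

It remains to see that u in ℓ^p produces f in the Bergman space. Since c₁c₂ < 1, one of the two
bounds on K is below 1, so all off-diagonal entries stay below a constant less than 1, and the
sequence is separated in the pseudohyperbolic sense (`exists_separation`). Separated points have
disjoint non-isotropic neighbourhoods on which the kernels are essentially constant. Sums of kernels
over the sequence are therefore dominated by integrals (`exists_tsum_kernel_le`), which the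
Forelli–Rudin estimate bounds (`exists_lintegral_forelliRudin_le`). A weighted Hölder argument then
yields the L^p bound (`lintegral_tsum_kernel_rpow_lt_top`). -/

/-! ### Adapted coordinates and weighted volume near the sphere -/

/-- Real coordinates `((Im w₀, (w₁, …, w_m)), Re w₀)` on `ℂ^(m+1)`. -/
noncomputable def reImCoord (m : ℕ) :
    EuclideanSpace ℂ (Fin (m + 1)) ≃ₗ[ℝ] (ℝ × (Fin m → ℂ)) × ℝ where
  toFun w := (((w 0).im, fun i => w i.succ), (w 0).re)
  invFun x := WithLp.toLp 2 (Fin.cons ⟨x.2, x.1.1⟩ x.1.2)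
  map_add' u v := by ext <;> simp
  map_smul' r v := by ext <;> simp
  left_inv w := by
    ext i
    refine Fin.cases ?_ (fun j => ?_) i <;> simp
  right_inv x := by ext <;> simp

/-- Uniqueness of Haar measure up to scaling. The scalar is never computed: only its being positive
and finite is used. -/
lemma exists_lintegral_reImCoord (m : ℕ) : ∃ C : ENNReal, C ≠ 0 ∧ C ≠ ⊤ ∧
    ∀ g : (ℝ × (Fin m → ℂ)) × ℝ → ENNReal,
      ∫⁻ w, g (reImCoord m w) = C * ∫⁻ x, g x := by
  let Φ := (reImCoord m).toContinuousLinearEquiv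
  let μ : Measure ((ℝ × (Fin m → ℂ)) × ℝ) := Measure.map Φ volume
  have : μ.IsAddHaarMeasure := Φ.isAddHaarMeasure_map volume
  have : (volume : Measure (ℝ × (Fin m → ℂ))).IsAddHaarMeasure :=
    Measure.prod.instIsAddHaarMeasure volume volume
  have : (volume : Measure ((ℝ × (Fin m → ℂ)) × ℝ)).IsAddHaarMeasure :=
    Measure.prod.instIsAddHaarMeasure volume volume
  have h := Measure.isAddLeftInvariant_eq_smul μ volume
  refine ⟨((μ.addHaarScalarFactor volume : NNReal) : ENNReal), ?_, ?_, fun g => ?_⟩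
  rotate_left 2
  · have h1 : ∫⁻ w, g (reImCoord m w) = ∫⁻ x, g x ∂μ :=
      (lintegral_map_equiv g Φ.toHomeomorph.toMeasurableEquiv).symm
    rw [h1]
    conv_lhs => rw [h, lintegral_smul_measure]
    rfl
  · exact_mod_cast (Measure.addHaarScalarFactor_pos_of_isAddHaarMeasure μ volume).ne'
  · exact ENNReal.coe_ne_top

lemma lintegral_rpow_Ioo {c R : ℝ} (hc : -1 < c) (hR : 0 < R) :
    ∫⁻ u in Set.Ioo 0 R, ENNReal.ofReal (u ^ c) = ENNReal.ofReal (R ^ (c + 1) / (c + 1)) := by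
  have hi : IntervalIntegrable (fun u : ℝ => u ^ c) volume 0 R :=
    intervalIntegral.intervalIntegrable_rpow' hc
  rw [intervalIntegrable_iff_integrableOn_Ioo_of_le hR.le] at hi
  rw [← ofReal_integral_eq_lintegral_ofReal hi, ← integral_Ioc_eq_integral_Ioo,
    ← intervalIntegral.integral_of_le hR.le, integral_rpow (Or.inl hc),
    Real.zero_rpow (by linarith), sub_zero]
  exact (ae_restrict_mem measurableSet_Ioo).mono fun u hu => Real.rpow_nonneg hu.1.le _

lemma rpow_le_two_rpow_abs {y c : ℝ} (h1 : 1 ≤ y) (h2 : y ≤ 2) : y ^ c ≤ 2 ^ |c| :=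
  (Real.rpow_le_rpow_of_exponent_le h1 (le_abs_self c)).trans
    (Real.rpow_le_rpow (by linarith) h2 (abs_nonneg c))

/-- Factor A - x² = (√A + x)(√A - x). The first factor lies in [1, 2] and costs only 2^|c|; the
second is the variable of a power integral over (0, R). The bound does not depend on A. -/
lemma lintegral_sub_sq_rpow_le {c R A : ℝ} (hc : -1 < c) (hR : 0 < R) (hR2 : R ≤ 1 / 2)
    (hA : A ≤ 1) :
    ∫⁻ x in {x : ℝ | 1 - R < x ∧ x ^ 2 < A}, ENNReal.ofReal ((A - x ^ 2) ^ c) ≤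
      ENNReal.ofReal (2 ^ |c| * (R ^ (c + 1) / (c + 1))) := by
  have hm : MeasurableSet {x : ℝ | 1 - R < x ∧ x ^ 2 < A} := by
    exact (measurableSet_lt measurable_const measurable_id).inter
      (measurableSet_lt (measurable_id.pow_const 2) measurable_const)
  rw [ENNReal.ofReal_mul (by positivity), ← lintegral_rpow_Ioo hc hR,
    ← lintegral_indicator hm, ← lintegral_indicator measurableSet_Ioo,
    ← lintegral_sub_left_eq_self ((Set.Ioo 0 R).indicator _) (Real.sqrt A),
    ← lintegral_const_mul' _ _ ENNReal.ofReal_ne_top]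
  refine lintegral_mono fun x => ?_
  by_cases hx : x ∈ {x : ℝ | 1 - R < x ∧ x ^ 2 < A}
  swap
  · rw [Set.indicator_of_notMem hx]; exact zero_le
  rw [Set.indicator_of_mem hx]
  obtain ⟨hx1, hx2⟩ := hx
  have hx0 : 0 < x := by linarith
  have hA0 : 0 ≤ A := (sq_nonneg x).trans hx2.le
  have hs1 : Real.sqrt A ≤ 1 := Real.sqrt_le_one.2 hA
  have hs2 : x < Real.sqrt A := Real.lt_sqrt_of_sq_lt hx2
  rw [Set.indicator_of_mem (by constructor <;> linarith), ← ENNReal.ofReal_mul (by positivity)]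
  apply ENNReal.ofReal_le_ofReal
  have : A - x ^ 2 = (Real.sqrt A + x) * (Real.sqrt A - x) := by
    nlinarith [Real.sq_sqrt hA0]
  rw [this, Real.mul_rpow (by linarith) (by linarith)]
  exact mul_le_mul_of_nonneg_right (rpow_le_two_rpow_abs (by linarith) (by linarith))
    (Real.rpow_nonneg (by linarith) _)

/-- Polar coordinates reduce this to the integrability of (1-r)^c on (0, 1), because 1-|w|² and
1-|w| are comparable. -/
lemma lintegral_ball_one_sub_norm_sq_rpow_lt_top (m : ℕ) {c : ℝ} (hc : -1 < c) :
    ∫⁻ w in unitBall (m + 1), ENNReal.ofReal ((1 - ‖w‖ ^ 2) ^ c) < ⊤ := by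
  have h1 : IntegrableOn (fun r : ℝ => (1 - r) ^ c) (Set.Ioo 0 1) := by
    have hi : IntervalIntegrable (fun u : ℝ => u ^ c) volume 0 1 :=
      intervalIntegral.intervalIntegrable_rpow' hc
    have := (hi.comp_sub_left 1).symm
    rw [sub_self, sub_zero, intervalIntegrable_iff_integrableOn_Ioo_of_le zero_le_one] at this
    exact this
  have h2 : IntegrableOn (fun w : EuclideanSpace ℂ (Fin (m + 1)) => (1 - ‖w‖) ^ c)
      (Metric.ball 0 1) := by
    rw [integrableOn_fun_norm_addHaar volume (f := fun r : ℝ => (1 - r) ^ c)]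
    refine Integrable.mono h1 (by fun_prop) ?_
    filter_upwards [ae_restrict_mem measurableSet_Ioo] with r hr
    rw [norm_smul]
    refine mul_le_of_le_one_left (norm_nonneg _) ?_
    rw [Real.norm_of_nonneg (by have := hr.1; positivity)]
    exact pow_le_one₀ hr.1.le hr.2.le
  have h3 := (h2.const_mul (2 ^ |c|)).lintegral_lt_top
  refine lt_of_le_of_lt ?_ h3
  refine setLIntegral_mono' measurableSet_ball fun w hw => ENNReal.ofReal_le_ofReal ?_
  have hw' : ‖w‖ < 1 := by simpa [unitBall] using hw
  have h0 := norm_nonneg w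
  have : 1 - ‖w‖ ^ 2 = (1 + ‖w‖) * (1 - ‖w‖) := by ring
  rw [this, Real.mul_rpow (by linarith) (by linarith)]
  exact mul_le_mul_of_nonneg_right (rpow_le_two_rpow_abs (by linarith) (by linarith))
    (Real.rpow_nonneg (by linarith) _)

lemma exists_linearIsometryEquiv_coord_zero {m : ℕ} {e : EuclideanSpace ℂ (Fin (m + 1))}
    (he : ‖e‖ = 1) :
    ∃ U : EuclideanSpace ℂ (Fin (m + 1)) ≃ₗᵢ[ℂ] EuclideanSpace ℂ (Fin (m + 1)),
      ∀ w, (U w) 0 = inner ℂ e w := by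
  have ho : Orthonormal ℂ (({0} : Set (Fin (m + 1))).domRestrict fun _ => e) := by
    refine ⟨fun i => he, fun i j hij => absurd (Subsingleton.elim i j) hij⟩
  obtain ⟨b, hb⟩ := ho.exists_orthonormalBasis_extension_of_card_eq (by simp)
  refine ⟨b.repr, fun w => ?_⟩
  rw [b.repr_apply_apply, hb 0 rfl]

/-- Real coordinates adapted to a unit vector `e`; the volume is a fixed multiple of the product
volume. -/
lemma exists_adapted_coord (m : ℕ) : ∃ C : ENNReal, C ≠ 0 ∧ C ≠ ⊤ ∧
    ∀ e : EuclideanSpace ℂ (Fin (m + 1)), ‖e‖ = 1 →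
      ∃ Φ : EuclideanSpace ℂ (Fin (m + 1)) → (ℝ × (Fin m → ℂ)) × ℝ,
        (∀ g : (ℝ × (Fin m → ℂ)) × ℝ → ENNReal, ∫⁻ w, g (Φ w) = C * ∫⁻ x, g x) ∧
        ∀ w, (inner ℂ e w : ℂ) = ⟨(Φ w).2, (Φ w).1.1⟩ ∧
          ‖w‖ ^ 2 = (Φ w).2 ^ 2 + (Φ w).1.1 ^ 2 + ∑ i, ‖(Φ w).1.2 i‖ ^ 2 := by
  obtain ⟨C, h0, ht, hC⟩ := exists_lintegral_reImCoord m
  refine ⟨C, h0, ht, fun e he => ?_⟩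
  obtain ⟨U, hU⟩ := exists_linearIsometryEquiv_coord_zero he
  let V : EuclideanSpace ℂ (Fin (m + 1)) ≃ₗᵢ[ℝ] EuclideanSpace ℂ (Fin (m + 1)) :=
    { U.toLinearEquiv.restrictScalars ℝ with norm_map' := U.norm_map }
  have hV : MeasurePreserving V volume volume := V.measurePreserving
  refine ⟨fun w => reImCoord m (U w), fun g => ?_, fun w => ⟨?_, ?_⟩⟩
  · rw [← hC g]
    exact hV.lintegral_comp_emb V.toHomeomorph.measurableEmbedding
      (fun v => g (reImCoord m v))
  · rw [← hU]; rfl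
  · rw [← U.norm_map w, EuclideanSpace.norm_sq_eq, Fin.sum_univ_succ, Complex.sq_norm,
      Complex.normSq_apply]
    simp only [reImCoord, LinearEquiv.coe_mk, LinearMap.coe_mk, AddHom.coe_mk]
    ring

lemma volume_reIm_box (m : ℕ) {r ρ : ℝ} (hr : 0 ≤ r) (hρ : 0 ≤ ρ) :
    volume (Set.Ioo (-r) r ×ˢ Set.univ.pi fun _ : Fin m => Metric.ball (0 : ℂ) ρ) =
      ENNReal.ofReal (2 * r * (Real.pi * ρ ^ 2) ^ m) := by
  rw [Measure.volume_eq_prod, Measure.prod_prod, volume_pi, Measure.pi_pi, Real.volume_Ioo]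
  simp only [Complex.volume_ball, Finset.prod_const, Finset.card_univ, Fintype.card_fin]
  rw [ENNReal.ofReal_mul (by positivity), ENNReal.ofReal_pow (by positivity),
    ENNReal.ofReal_mul Real.pi_pos.le, ENNReal.ofReal_pow hρ, mul_comm (ENNReal.ofReal Real.pi),
    ← NNReal.coe_real_pi, ENNReal.ofReal_coe_nnreal]
  congr 2; ring

lemma measurableSet_reIm_box (m : ℕ) (r ρ : ℝ) :
    MeasurableSet (Set.Ioo (-r) r ×ˢ Set.univ.pi fun _ : Fin m => Metric.ball (0 : ℂ) ρ) :=
  measurableSet_Ioo.prod (MeasurableSet.univ_pi fun _ => measurableSet_ball)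

/-- Weighted volume of the part of the ball near a boundary point `e`. -/
lemma exists_lintegral_near_boundary_le (m : ℕ) {c : ℝ} (hc : -1 < c) :
    ∃ C : ENNReal, C ≠ ⊤ ∧ ∀ e : EuclideanSpace ℂ (Fin (m + 1)), ‖e‖ = 1 →
      ∀ R : ℝ, 0 < R → R ≤ 1 / 2 →
      ∫⁻ w in {w | w ∈ unitBall (m + 1) ∧ ‖1 - inner ℂ e w‖ < R},
        ENNReal.ofReal ((1 - ‖w‖ ^ 2) ^ c) ≤ C * ENNReal.ofReal (R ^ ((m : ℝ) + 2 + c)) := by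
  obtain ⟨C, h0, ht, hC⟩ := exists_adapted_coord m
  refine ⟨C * ENNReal.ofReal (2 ^ |c| * (1 / (c + 1)) * (2 * (Real.pi * 2) ^ m)),
    ENNReal.mul_ne_top ht ENNReal.ofReal_ne_top, fun e he R hR hR2 => ?_⟩
  obtain ⟨Φ, hΦ, hw⟩ := hC e he
  have hs : MeasurableSet {w : EuclideanSpace ℂ (Fin (m + 1)) |
      w ∈ unitBall (m + 1) ∧ ‖1 - inner ℂ e w‖ < R} :=
    MeasurableSet.inter measurableSet_ball (measurableSet_lt
      (f := fun w => ‖1 - inner ℂ e w‖) (by fun_prop) measurable_const)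
  -- The condition |1-⟨e,w⟩| < R confines Im w₀ to (-R, R) and gives Re w₀ > 1-R. The remaining
  -- coordinates then have square sum at most 1-(1-R)² ≤ 2R. Integrating first in Re w₀ gives
  -- R^(c+1), and the box contributes a multiple of R · R^m.
  let S := Set.Ioo (-R) R ×ˢ Set.univ.pi fun _ : Fin m => Metric.ball (0 : ℂ) (Real.sqrt (2 * R))
  let A : ℝ × (Fin m → ℂ) → ℝ := fun y => 1 - y.1 ^ 2 - ∑ i, ‖y.2 i‖ ^ 2
  let g : (ℝ × (Fin m → ℂ)) × ℝ → ENNReal := fun x => S.indicator (fun y =>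
    {t : ℝ | 1 - R < t ∧ t ^ 2 < A y}.indicator (fun t => ENNReal.ofReal ((A y - t ^ 2) ^ c)) x.2)
    x.1
  have hle : ∫⁻ w in {w | w ∈ unitBall (m + 1) ∧ ‖1 - inner ℂ e w‖ < R},
        ENNReal.ofReal ((1 - ‖w‖ ^ 2) ^ c) ≤ ∫⁻ w, g (Φ w) := by
    rw [← lintegral_indicator hs]
    refine lintegral_mono fun w => ?_
    by_cases hwS : w ∈ {w | w ∈ unitBall (m + 1) ∧ ‖1 - inner ℂ e w‖ < R}
    swap
    · rw [Set.indicator_of_notMem hwS]; exact zero_le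
    rw [Set.indicator_of_mem hwS]
    obtain ⟨hw1, hw2⟩ := hwS
    obtain ⟨hin, hn⟩ := hw w
    have hw1 : ‖w‖ < 1 := by simpa [unitBall] using hw1
    have hw3 : ‖w‖ ^ 2 < 1 := by nlinarith [norm_nonneg w]
    have hre := (Complex.abs_re_le_norm _).trans_lt hw2
    have him := (Complex.abs_im_le_norm _).trans_lt hw2
    rw [hin] at hre him
    simp only [Complex.sub_re, Complex.one_re, Complex.sub_im, Complex.one_im] at hre him
    rw [abs_lt] at hre him
    have hx : 1 - R < (Φ w).2 := by linarith [hre.2]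
    have hsum : ∀ i, ‖(Φ w).1.2 i‖ ^ 2 ≤ ∑ i, ‖(Φ w).1.2 i‖ ^ 2 := fun i =>
      Finset.single_le_sum (f := fun i => ‖(Φ w).1.2 i‖ ^ 2) (fun j _ => sq_nonneg _)
        (Finset.mem_univ i)
    have hS : (Φ w).1 ∈ S := by
      refine ⟨⟨by linarith, by linarith⟩, fun i _ => ?_⟩
      rw [mem_ball_zero_iff]
      apply Real.lt_sqrt_of_sq_lt
      nlinarith [hsum i, sq_nonneg (Φ w).1.1]
    have hA : A (Φ w).1 - (Φ w).2 ^ 2 = 1 - ‖w‖ ^ 2 := by simp only [A, hn]; ring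
    simp only [g]
    have hmem : (Φ w).2 ∈ {t : ℝ | 1 - R < t ∧ t ^ 2 < A (Φ w).1} := ⟨hx, by linarith⟩
    rw [Set.indicator_of_mem hS, Set.indicator_of_mem hmem, hA]
  refine hle.trans ?_
  rw [hΦ, mul_assoc]
  refine mul_le_mul_right ?_ C
  rw [Measure.volume_eq_prod]
  refine (lintegral_prod_le _).trans ?_
  have hin : ∀ y, ∫⁻ t, g (y, t) ≤
      S.indicator (fun _ => ENNReal.ofReal (2 ^ |c| * (R ^ (c + 1) / (c + 1)))) y := by
    intro y
    by_cases hy : y ∈ S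
    · have hm : MeasurableSet {x : ℝ | 1 - R < x ∧ x ^ 2 < A y} :=
        (measurableSet_lt measurable_const measurable_id).inter
          (measurableSet_lt (measurable_id.pow_const 2) measurable_const)
      simp only [g, Set.indicator_of_mem hy]
      rw [lintegral_indicator hm]
      refine lintegral_sub_sq_rpow_le hc hR hR2 ?_
      have : 0 ≤ ∑ i, ‖y.2 i‖ ^ 2 := Finset.sum_nonneg fun i _ => sq_nonneg _
      simp only [A]
      nlinarith [sq_nonneg y.1]
    · simp [g, Set.indicator_of_notMem hy]
  refine (lintegral_mono hin).trans ?_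
  rw [lintegral_indicator (measurableSet_reIm_box m _ _), setLIntegral_const,
    volume_reIm_box m hR.le (Real.sqrt_nonneg _), Real.sq_sqrt (by positivity),
    ← ENNReal.ofReal_mul (by have : 0 < c + 1 := by linarith
                             positivity),
    ← ENNReal.ofReal_mul (by have : 0 < c + 1 := by linarith
                             positivity)]
  apply le_of_eq
  congr 1
  have hRR : R ^ ((m : ℝ) + 2 + c) = R ^ (c + 1) * R * R ^ m := by
    rw [show (m : ℝ) + 2 + c = (c + 1) + 1 + m by ring, Real.rpow_add hR, Real.rpow_add hR (c + 1),
      Real.rpow_natCast, Real.rpow_one]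
  rw [hRR, ← mul_assoc Real.pi 2 R, mul_pow _ R]
  ring

/-! ### Non-isotropic balls and the Forelli–Rudin estimate -/

lemma norm_one_sub_inner_comm {n : ℕ} (z w : EuclideanSpace ℂ (Fin n)) :
    ‖1 - inner ℂ z w‖ = ‖1 - inner ℂ w z‖ := by
  rw [← inner_conj_symm z w, ← RCLike.norm_conj]
  simp

lemma one_sub_norm_sq_pos {n : ℕ} {z : EuclideanSpace ℂ (Fin n)} (hz : z ∈ unitBall n) :
    0 < 1 - ‖z‖ ^ 2 := by
  have : ‖z‖ < 1 := by simpa [unitBall] using hz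
  nlinarith [norm_nonneg z]

lemma one_sub_norm_sq_le_one {n : ℕ} (z : EuclideanSpace ℂ (Fin n)) : 1 - ‖z‖ ^ 2 ≤ 1 := by
  nlinarith [norm_nonneg z]

lemma one_sub_norm_sq_le {n : ℕ} {z w : EuclideanSpace ℂ (Fin n)} (hz : z ∈ unitBall n)
    (hw : w ∈ unitBall n) : 1 - ‖z‖ ^ 2 ≤ 2 * ‖1 - inner ℂ z w‖ := by
  have hz : ‖z‖ < 1 := by simpa [unitBall] using hz
  have hw : ‖w‖ < 1 := by simpa [unitBall] using hw
  have h1 : 1 - ‖z‖ * ‖w‖ ≤ ‖1 - inner ℂ z w‖ := by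
    have := norm_sub_norm_le (1 : ℂ) (inner ℂ z w)
    have h2 := norm_inner_le_norm (𝕜 := ℂ) z w
    rw [norm_one] at this
    linarith
  nlinarith [norm_nonneg z, norm_nonneg w]

lemma norm_one_sub_inner_pos {n : ℕ} {z w : EuclideanSpace ℂ (Fin n)} (hz : z ∈ unitBall n)
    (hw : w ∈ unitBall n) : 0 < ‖1 - inner ℂ z w‖ := by
  linarith [one_sub_norm_sq_le hz hw, one_sub_norm_sq_pos hz]

lemma exists_unit_smul_eq {m : ℕ} (z : EuclideanSpace ℂ (Fin (m + 1))) :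
    ∃ e : EuclideanSpace ℂ (Fin (m + 1)), ‖e‖ = 1 ∧ z = (‖z‖ : ℂ) • e := by
  rcases eq_or_ne z 0 with rfl | hz
  · exact ⟨EuclideanSpace.single 0 1, by simp, by simp⟩
  · have : (‖z‖ : ℂ) ≠ 0 := by simpa using hz
    refine ⟨(‖z‖ : ℂ)⁻¹ • z, ?_, ?_⟩
    · rw [norm_smul, norm_inv, Complex.norm_real, norm_norm, inv_mul_cancel₀ (by simpa using hz)]
    · rw [smul_smul, mul_inv_cancel₀ this, one_smul]

lemma measurableSet_ball_inter {n : ℕ} (z : EuclideanSpace ℂ (Fin n)) (R : ℝ) :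
    MeasurableSet {w | w ∈ unitBall n ∧ ‖1 - inner ℂ z w‖ < R} :=
  MeasurableSet.inter measurableSet_ball (measurableSet_lt
    (f := fun w => ‖1 - inner ℂ z w‖) (by fun_prop) measurable_const)

/-- Weighted volume of non-isotropic balls, uniformly in the centre. -/
lemma exists_lintegral_nonisotropic_ball_le (m : ℕ) {c : ℝ} (hc : -1 < c) :
    ∃ C : ENNReal, C ≠ ⊤ ∧ ∀ z ∈ unitBall (m + 1), ∀ R : ℝ, 0 < R →
      ∫⁻ w in {w | w ∈ unitBall (m + 1) ∧ ‖1 - inner ℂ z w‖ < R},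
        ENNReal.ofReal ((1 - ‖w‖ ^ 2) ^ c) ≤ C * ENNReal.ofReal (R ^ ((m : ℝ) + 2 + c)) := by
  obtain ⟨C, hC, h⟩ := exists_lintegral_near_boundary_le m hc
  have hT := lintegral_ball_one_sub_norm_sq_rpow_lt_top m hc
  set T := ∫⁻ w in unitBall (m + 1), ENNReal.ofReal ((1 - ‖w‖ ^ 2) ^ c)
  set k : ℝ := (m : ℝ) + 2 + c with hk
  have hk0 : 0 < k := by have : (0 : ℝ) ≤ m := m.cast_nonneg
                         linarith
  refine ⟨C * ENNReal.ofReal (2 ^ k) + T * ENNReal.ofReal (4 ^ k),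
    ENNReal.add_ne_top.2 ⟨ENNReal.mul_ne_top hC ENNReal.ofReal_ne_top,
      ENNReal.mul_ne_top hT.ne ENNReal.ofReal_ne_top⟩, fun z hz R hR => ?_⟩
  rw [add_mul]
  -- For small R the centre moves to its radial projection e: as 1-|z| ≤ |1-⟨z,w⟩| < R, the radius
  -- at most doubles and stays within 1/2. For large R the whole ball suffices, since (4R)^k ≥ 1.
  rcases le_or_gt R (1 / 4) with hR4 | hR4
  · refine le_trans ?_ le_self_add
    obtain ⟨e, he, hze⟩ := exists_unit_smul_eq z
    have hz1 : ‖z‖ < 1 := by simpa [unitBall] using hz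
    have h2 := h e he (2 * R) (by positivity) (by linarith)
    rw [Real.mul_rpow (by norm_num) hR.le, ENNReal.ofReal_mul (by positivity), ← mul_assoc] at h2
    refine le_trans (lintegral_mono_set ?_) h2
    rintro w ⟨hw, hwR⟩
    refine ⟨hw, ?_⟩
    have hw1 : ‖w‖ < 1 := by simpa [unitBall] using hw
    have h3 : (1 : ℂ) - inner ℂ e w = (1 - inner ℂ z w) - (1 - (‖z‖ : ℂ)) * inner ℂ e w := by
      conv_rhs => rw [hze, inner_smul_left, Complex.conj_ofReal]
      rw [norm_smul, he, Complex.norm_real, norm_norm, mul_one]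
      ring
    have h4 : ‖(1 - (‖z‖ : ℂ)) * inner ℂ e w‖ ≤ 1 - ‖z‖ := by
      rw [norm_mul, ← Complex.ofReal_one, ← Complex.ofReal_sub, Complex.norm_real,
        Real.norm_of_nonneg (by linarith)]
      refine mul_le_of_le_one_right (by linarith) ?_
      have := norm_inner_le_norm (𝕜 := ℂ) e w
      rw [he] at this
      linarith
    have h5 : 1 - ‖z‖ ≤ ‖1 - inner ℂ z w‖ := by
      have := norm_sub_norm_le (1 : ℂ) (inner ℂ z w)
      have h2 := norm_inner_le_norm (𝕜 := ℂ) z w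
      rw [norm_one] at this
      nlinarith [norm_nonneg z, norm_nonneg w]
    rw [h3]
    linarith [norm_sub_le (1 - inner ℂ z w) ((1 - (‖z‖ : ℂ)) * inner ℂ e w)]
  · refine le_trans ?_ le_add_self
    refine le_trans (lintegral_mono_set (t := unitBall (m + 1)) fun w hw => hw.1) ?_
    rw [mul_assoc, ← ENNReal.ofReal_mul (by positivity), ← Real.mul_rpow (by norm_num) hR.le]
    refine le_mul_of_one_le_right' ?_
    rw [ENNReal.one_le_ofReal]
    exact Real.one_le_rpow (by linarith) hk0.le

/-- The Forelli–Rudin estimate on the ball. -/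
lemma exists_lintegral_forelliRudin_le (m : ℕ) {c d : ℝ} (hc : -1 < c) (hd : 0 < d) :
    ∃ C : ENNReal, C ≠ ⊤ ∧ ∀ z ∈ unitBall (m + 1),
      ∫⁻ w in unitBall (m + 1),
        ENNReal.ofReal ((1 - ‖w‖ ^ 2) ^ c / ‖1 - inner ℂ z w‖ ^ ((m : ℝ) + 2 + c + d)) ≤
        C * ENNReal.ofReal ((1 - ‖z‖ ^ 2) ^ (-d)) := by
  obtain ⟨C, hC, h⟩ := exists_lintegral_nonisotropic_ball_le m hc
  set M : ℝ := (m : ℝ) + 2 + c + d with hM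
  have hM0 : 0 < M := by have : (0 : ℝ) ≤ m := m.cast_nonneg
                         linarith
  have hr1 : ENNReal.ofReal (2 ^ (-d)) < 1 := by
    rw [ENNReal.ofReal_lt_one]
    exact Real.rpow_lt_one_of_one_lt_of_neg one_lt_two (by linarith)
  refine ⟨C * ENNReal.ofReal (2 ^ M) * (1 - ENNReal.ofReal (2 ^ (-d)))⁻¹,
    ENNReal.mul_ne_top (ENNReal.mul_ne_top hC ENNReal.ofReal_ne_top)
      (ENNReal.inv_ne_top.2 (tsub_pos_of_lt hr1).ne'), fun z hz => ?_⟩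
  set δ := 1 - ‖z‖ ^ 2 with hδ
  have hδ0 : 0 < δ := one_sub_norm_sq_pos hz
  -- Dyadic shells 2^k δ/2 ≤ |1-⟨z,w⟩| < 2^k δ. They start at k = 0 because δ ≤ 2|1-⟨z,w⟩|. The k-th
  -- one contributes at most a constant times (2^k δ)^(-d), a geometric series of ratio 2^(-d).
  let S : ℕ → Set (EuclideanSpace ℂ (Fin (m + 1))) := fun k =>
    {w | w ∈ unitBall (m + 1) ∧ ‖1 - inner ℂ z w‖ < 2 ^ k * δ}
  have hS : ∀ k, MeasurableSet (S k) := fun k => measurableSet_ball_inter z _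
  let F : ℕ → EuclideanSpace ℂ (Fin (m + 1)) → ENNReal := fun k w =>
    ENNReal.ofReal ((2 ^ k * δ / 2) ^ (-M)) *
      (S k).indicator (fun w => ENNReal.ofReal ((1 - ‖w‖ ^ 2) ^ c)) w
  have hFm : ∀ k, Measurable (F k) := fun k => by
    refine Measurable.const_mul (Measurable.indicator ?_ (hS k)) _
    fun_prop
  have hpt : ∀ w ∈ unitBall (m + 1),
      ENNReal.ofReal ((1 - ‖w‖ ^ 2) ^ c / ‖1 - inner ℂ z w‖ ^ M) ≤ ∑' k, F k w := by
    intro w hw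
    have hX : δ ≤ 2 * ‖1 - inner ℂ z w‖ := one_sub_norm_sq_le hz hw
    obtain ⟨k, hk1, hk2⟩ := exists_nat_pow_near (x := 2 * ‖1 - inner ℂ z w‖ / δ)
      ((one_le_div hδ0).2 hX) one_lt_two
    rw [le_div_iff₀ hδ0] at hk1
    rw [div_lt_iff₀ hδ0, pow_succ] at hk2
    refine le_trans ?_ (ENNReal.le_tsum k)
    have hwS : w ∈ S k := ⟨hw, by linarith⟩
    simp only [F]
    rw [Set.indicator_of_mem hwS, ← ENNReal.ofReal_mul (by positivity)]
    apply ENNReal.ofReal_le_ofReal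
    rw [div_eq_mul_inv, mul_comm, ← Real.rpow_neg (norm_nonneg _)]
    refine mul_le_mul_of_nonneg_right ?_ (Real.rpow_nonneg (one_sub_norm_sq_pos hw).le _)
    exact Real.rpow_le_rpow_of_nonpos (by positivity) (by linarith) (by linarith)
  calc ∫⁻ w in unitBall (m + 1), ENNReal.ofReal ((1 - ‖w‖ ^ 2) ^ c / ‖1 - inner ℂ z w‖ ^ M)
      ≤ ∫⁻ w in unitBall (m + 1), ∑' k, F k w :=
        setLIntegral_mono' measurableSet_ball hpt
    _ ≤ ∫⁻ w, ∑' k, F k w := setLIntegral_le_lintegral _ _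
    _ = ∑' k, ∫⁻ w, F k w := lintegral_tsum fun k => (hFm k).aemeasurable
    _ ≤ ∑' k, C * ENNReal.ofReal (2 ^ M) * ENNReal.ofReal (δ ^ (-d)) *
          ENNReal.ofReal (2 ^ (-d)) ^ k := by
        refine ENNReal.tsum_le_tsum fun k => ?_
        simp only [F]
        rw [lintegral_const_mul' _ _ ENNReal.ofReal_ne_top, lintegral_indicator (hS k)]
        refine (mul_le_mul_right (h z hz (2 ^ k * δ) (by positivity)) _).trans ?_
        rw [mul_left_comm, mul_assoc C, mul_assoc C, ← ENNReal.ofReal_mul (by positivity),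
          ← ENNReal.ofReal_mul (by positivity), ← ENNReal.ofReal_pow (by positivity),
          ← ENNReal.ofReal_mul (by positivity)]
        apply le_of_eq
        congr 2
        have hb : (0 : ℝ) < 2 ^ k * δ := by positivity
        rw [Real.div_rpow hb.le zero_le_two, Real.rpow_neg zero_le_two M, div_inv_eq_mul,
          mul_right_comm, ← Real.rpow_add hb, mul_comm _ ((2 : ℝ) ^ M), mul_assoc]
        congr 1
        rw [show -M + ((m : ℝ) + 2 + c) = -d by rw [hM]; ring, Real.mul_rpow (by positivity) hδ0.le,
          mul_comm, ← Real.rpow_natCast, ← Real.rpow_natCast, ← Real.rpow_mul zero_le_two,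
          ← Real.rpow_mul zero_le_two, mul_comm (k : ℝ)]
    _ = _ := by
        rw [ENNReal.tsum_mul_left, ENNReal.tsum_geometric]
        ring

/-! ### Non-isotropic neighbourhoods: kernel stability, overlap, volume -/

/-- A non-isotropic neighbourhood of `a`, of size `κ (1 - |a|²)` in the direction of `a` and
`κ (1 - |a|²)^(1/2)` in the orthogonal directions. -/
def nonisotropicNhd {n : ℕ} (κ : ℝ) (a : EuclideanSpace ℂ (Fin n)) :
    Set (EuclideanSpace ℂ (Fin n)) :=
  {w | ‖inner ℂ a (w - a)‖ < κ * (1 - ‖a‖ ^ 2) ∧ ‖w - a‖ ^ 2 < κ ^ 2 * (1 - ‖a‖ ^ 2)}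

section nonisotropicNhd

variable {n : ℕ} {κ : ℝ} {a w z : EuclideanSpace ℂ (Fin n)}

lemma measurableSet_nonisotropicNhd (κ : ℝ) (a : EuclideanSpace ℂ (Fin n)) :
    MeasurableSet (nonisotropicNhd κ a) :=
  (measurableSet_lt (f := fun w => ‖inner ℂ a (w - a)‖) (by fun_prop) measurable_const).inter
    (measurableSet_lt (f := fun w => ‖w - a‖ ^ 2) (by fun_prop) measurable_const)

lemma norm_sq_eq_of_sub (a w : EuclideanSpace ℂ (Fin n)) :
    ‖w‖ ^ 2 = ‖a‖ ^ 2 + 2 * (inner ℂ a (w - a)).re + ‖w - a‖ ^ 2 := by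
  have := norm_add_sq (𝕜 := ℂ) a (w - a)
  rwa [add_sub_cancel] at this

lemma one_sub_norm_sq_le_of_mem (hw : w ∈ nonisotropicNhd κ a) :
    1 - ‖w‖ ^ 2 ≤ (1 + 2 * κ) * (1 - ‖a‖ ^ 2) := by
  have h1 := neg_abs_le (inner ℂ a (w - a)).re
  have h2 := Complex.abs_re_le_norm (inner ℂ a (w - a))
  have h3 := norm_sq_eq_of_sub a w
  nlinarith [hw.1, sq_nonneg ‖w - a‖]

lemma le_one_sub_norm_sq_of_mem (hw : w ∈ nonisotropicNhd κ a) :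
    (1 - 2 * κ - κ ^ 2) * (1 - ‖a‖ ^ 2) ≤ 1 - ‖w‖ ^ 2 := by
  have h1 := le_abs_self (inner ℂ a (w - a)).re
  have h2 := Complex.abs_re_le_norm (inner ℂ a (w - a))
  have h3 := norm_sq_eq_of_sub a w
  nlinarith [hw.1, hw.2]

lemma mem_unitBall_of_mem_nonisotropicNhd (hκ : 0 < κ) (hκ1 : κ ≤ 1 / 16) (ha : a ∈ unitBall n)
    (hw : w ∈ nonisotropicNhd κ a) : w ∈ unitBall n := by
  have h := le_one_sub_norm_sq_of_mem hw
  have h1 := one_sub_norm_sq_pos ha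
  have : 0 < 1 - ‖w‖ ^ 2 := lt_of_lt_of_le (mul_pos (by nlinarith) h1) h
  simp only [unitBall, mem_ball_zero_iff]
  nlinarith [norm_nonneg w]

/-- Split z = (z-a) + a. The part along a is controlled by the radial size of the neighbourhood. The
other part uses Cauchy–Schwarz with |z-a|² ≤ 2|1-⟨z,a⟩|, which is why transverse size (1-|a|²)^(1/2)
is affordable. -/
lemma norm_inner_sub_le_of_mem (hκ : 0 < κ) (ha : a ∈ unitBall n) (hz : z ∈ unitBall n)
    (hw : w ∈ nonisotropicNhd κ a) :
    ‖(inner ℂ z (w - a) : ℂ)‖ ≤ 4 * κ * ‖1 - inner ℂ z a‖ := by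
  set X := ‖1 - inner ℂ z a‖ with hX
  have hX0 : 0 < X := norm_one_sub_inner_pos hz ha
  have hδ : 1 - ‖a‖ ^ 2 ≤ 2 * X := by
    rw [hX, norm_one_sub_inner_comm]; exact one_sub_norm_sq_le ha hz
  have hz1 : ‖z‖ < 1 := by simpa [unitBall] using hz
  have ha1 : ‖a‖ < 1 := by simpa [unitBall] using ha
  have h1 : ‖z - a‖ ^ 2 ≤ 2 * X := by
    have h := norm_sub_sq (𝕜 := ℂ) z a
    have h2 := Complex.re_le_norm (1 - inner ℂ z a)
    rw [Complex.sub_re, Complex.one_re] at h2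
    have h3 : RCLike.re (inner ℂ z a : ℂ) = (inner ℂ z a : ℂ).re := rfl
    rw [h3] at h
    nlinarith [norm_nonneg z, norm_nonneg a]
  have h2 : ‖(inner ℂ (z - a) (w - a) : ℂ)‖ ≤ 2 * κ * X := by
    refine (norm_inner_le_norm _ _).trans (abs_le_of_sq_le_sq' ?_ (by positivity)).2
    have h3 : ‖w - a‖ ^ 2 ≤ κ ^ 2 * (2 * X) := hw.2.le.trans (by gcongr)
    calc (‖z - a‖ * ‖w - a‖) ^ 2 = ‖z - a‖ ^ 2 * ‖w - a‖ ^ 2 := by ring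
      _ ≤ (2 * X) * (κ ^ 2 * (2 * X)) := by gcongr
      _ = (2 * κ * X) ^ 2 := by ring
  have h3 : (inner ℂ z (w - a) : ℂ) = inner ℂ (z - a) (w - a) + inner ℂ a (w - a) := by
    rw [← inner_add_left, sub_add_cancel]
  rw [h3]
  refine (norm_add_le _ _).trans ?_
  nlinarith [hw.1]

lemma norm_one_sub_inner_le_of_mem (hκ : 0 < κ) (ha : a ∈ unitBall n) (hz : z ∈ unitBall n)
    (hw : w ∈ nonisotropicNhd κ a) :
    ‖1 - inner ℂ z w‖ ≤ (1 + 4 * κ) * ‖1 - inner ℂ z a‖ := by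
  have h := norm_inner_sub_le_of_mem hκ ha hz hw
  have h3 : (1 : ℂ) - inner ℂ z w = (1 - inner ℂ z a) - inner ℂ z (w - a) := by
    rw [inner_sub_right]; ring
  rw [h3]
  linarith [norm_sub_le (1 - inner ℂ z a) (inner ℂ z (w - a))]

lemma le_norm_one_sub_inner_of_mem (hκ : 0 < κ) (ha : a ∈ unitBall n) (hz : z ∈ unitBall n)
    (hw : w ∈ nonisotropicNhd κ a) :
    (1 - 4 * κ) * ‖1 - inner ℂ z a‖ ≤ ‖1 - inner ℂ z w‖ := by
  have h := norm_inner_sub_le_of_mem hκ ha hz hw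
  have h3 : (1 : ℂ) - inner ℂ z w = (1 - inner ℂ z a) - inner ℂ z (w - a) := by
    rw [inner_sub_right]; ring
  rw [h3]
  linarith [norm_sub_norm_le (1 - inner ℂ z a) (inner ℂ z (w - a))]

/-- Replace first b and then a by the common point w in 1-⟨a,b⟩, each time at the cost of a factor
1-4κ. This ends at 1-|w|², which is at most 1+2κ times either 1-|a|² or 1-|b|². -/
lemma norm_one_sub_inner_sq_le_of_overlap (hκ : 0 < κ) (hκ1 : κ ≤ 1 / 16)
    {b : EuclideanSpace ℂ (Fin n)} (ha : a ∈ unitBall n) (hb : b ∈ unitBall n)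
    (hwa : w ∈ nonisotropicNhd κ a) (hwb : w ∈ nonisotropicNhd κ b) :
    (1 - 4 * κ) ^ 4 * ‖1 - inner ℂ a b‖ ^ 2 ≤
      (1 + 2 * κ) ^ 2 * ((1 - ‖a‖ ^ 2) * (1 - ‖b‖ ^ 2)) := by
  have hw := mem_unitBall_of_mem_nonisotropicNhd hκ hκ1 ha hwa
  have hw0 := one_sub_norm_sq_pos hw
  have h1 := le_norm_one_sub_inner_of_mem hκ hb ha hwb
  have h2 := le_norm_one_sub_inner_of_mem hκ ha hw hwa
  rw [norm_one_sub_inner_comm w a, inner_self_eq_norm_sq_to_K] at h2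
  have h3 : ‖(1 : ℂ) - (‖w‖ : ℂ) ^ 2‖ = 1 - ‖w‖ ^ 2 := by
    rw [← Complex.ofReal_pow, ← Complex.ofReal_one, ← Complex.ofReal_sub, Complex.norm_real,
      Real.norm_of_nonneg hw0.le]
  rw [show ((RCLike.ofReal ‖w‖ : ℂ)) = (‖w‖ : ℂ) from rfl, h3] at h2
  have hκ4 : 0 ≤ 1 - 4 * κ := by linarith
  have h4 : (1 - 4 * κ) ^ 2 * ‖1 - inner ℂ a b‖ ≤ 1 - ‖w‖ ^ 2 := by
    nlinarith [mul_le_mul_of_nonneg_left h1 hκ4]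
  have h5 : ((1 - 4 * κ) ^ 2 * ‖1 - inner ℂ a b‖) ^ 2 ≤ (1 - ‖w‖ ^ 2) * (1 - ‖w‖ ^ 2) := by
    rw [← sq]; gcongr
  have h6 : (1 - ‖w‖ ^ 2) * (1 - ‖w‖ ^ 2) ≤
      ((1 + 2 * κ) * (1 - ‖a‖ ^ 2)) * ((1 + 2 * κ) * (1 - ‖b‖ ^ 2)) :=
    mul_le_mul (one_sub_norm_sq_le_of_mem hwa) (one_sub_norm_sq_le_of_mem hwb) hw0.le
      (hw0.le.trans (one_sub_norm_sq_le_of_mem hwa))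
  calc _ = ((1 - 4 * κ) ^ 2 * ‖1 - inner ℂ a b‖) ^ 2 := by ring
    _ ≤ _ := h5.trans h6
    _ = _ := by ring

end nonisotropicNhd

/-- After translating a to the origin, the neighbourhood contains a box in the adapted coordinates:
two real sides of order 1-|a|² and m complex discs of radius of order (1-|a|²)^(1/2). -/
lemma exists_le_volume_nonisotropicNhd (m : ℕ) {κ : ℝ} (hκ : 0 < κ) :
    ∃ C : ENNReal, C ≠ 0 ∧ ∀ a ∈ unitBall (m + 1),
      C * ENNReal.ofReal ((1 - ‖a‖ ^ 2) ^ (m + 2)) ≤ volume (nonisotropicNhd κ a) := by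
  obtain ⟨C, h0, ht, hC⟩ := exists_adapted_coord m
  -- There are m + 2 squares in ‖v‖² (two real coordinates and m complex ones), so shrinking κ by
  -- this factor makes the whole box fit.
  set L : ℝ := m + 2 with hL
  have hL0 : 0 < L := by positivity
  have hL2 : 2 ≤ L := by rw [hL]; linarith [(m.cast_nonneg : (0 : ℝ) ≤ m)]
  refine ⟨C * ENNReal.ofReal (2 * (κ / L) * (Real.pi * (κ / L) ^ 2) ^ m * (2 * (κ / L))),
    mul_ne_zero h0 (by rw [Ne, ENNReal.ofReal_eq_zero, not_le]; positivity), fun a ha => ?_⟩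
  obtain ⟨e, he, hae⟩ := exists_unit_smul_eq a
  obtain ⟨Φ, hΦ, hw⟩ := hC e he
  have ha1 : ‖a‖ < 1 := by simpa [unitBall] using ha
  set δ := 1 - ‖a‖ ^ 2 with hδ
  have hδ0 : 0 < δ := one_sub_norm_sq_pos ha
  have hδ1 : δ ≤ 1 := one_sub_norm_sq_le_one a
  set η := κ / L with hη
  have hη0 : 0 < η := by positivity
  have hηL : η * L = κ := by rw [hη]; field_simp
  let S := (Set.Ioo (-(η * δ)) (η * δ) ×ˢ
    Set.univ.pi fun _ : Fin m => Metric.ball (0 : ℂ) (η * Real.sqrt δ)) ×ˢ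
      Set.Ioo (-(η * δ)) (η * δ)
  have hS : MeasurableSet S := (measurableSet_reIm_box m _ _).prod measurableSet_Ioo
  have hvS : volume S = ENNReal.ofReal (2 * η * (Real.pi * η ^ 2) ^ m * (2 * η)) *
      ENNReal.ofReal (δ ^ (m + 2)) := by
    rw [Measure.volume_eq_prod, Measure.prod_prod, volume_reIm_box m (by positivity) (by positivity),
      Real.volume_Ioo, ← ENNReal.ofReal_mul (by positivity), ← ENNReal.ofReal_mul (by positivity),
      mul_pow η, Real.sq_sqrt hδ0.le, ← mul_assoc Real.pi, mul_pow _ δ]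
    congr 1
    ring
  have htr : volume (nonisotropicNhd κ a) =
      volume {v : EuclideanSpace ℂ (Fin (m + 1)) |
        ‖inner ℂ a v‖ < κ * (1 - ‖a‖ ^ 2) ∧ ‖v‖ ^ 2 < κ ^ 2 * (1 - ‖a‖ ^ 2)} :=
    (measurePreserving_sub_right volume a).measure_preimage_emb
      (MeasurableEquiv.subRight a).measurableEmbedding
      {v | ‖inner ℂ a v‖ < κ * (1 - ‖a‖ ^ 2) ∧ ‖v‖ ^ 2 < κ ^ 2 * (1 - ‖a‖ ^ 2)}
  have hsub : ∀ v, Φ v ∈ S → v ∈ {v : EuclideanSpace ℂ (Fin (m + 1)) |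
        ‖inner ℂ a v‖ < κ * (1 - ‖a‖ ^ 2) ∧ ‖v‖ ^ 2 < κ ^ 2 * (1 - ‖a‖ ^ 2)} := by
    rintro v ⟨⟨⟨hy1, hy2⟩, hz⟩, hx1, hx2⟩
    obtain ⟨hin, hn⟩ := hw v
    have hx : |(Φ v).2| < η * δ := abs_lt.2 ⟨hx1, hx2⟩
    have hy : |(Φ v).1.1| < η * δ := abs_lt.2 ⟨hy1, hy2⟩
    constructor
    · have h1 : ‖(inner ℂ a v : ℂ)‖ ≤ ‖(inner ℂ e v : ℂ)‖ := by
        conv_lhs => rw [hae, inner_smul_left, norm_mul, RCLike.norm_conj, Complex.norm_real,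
          norm_norm]
        exact mul_le_of_le_one_left (norm_nonneg _) ha1.le
      have h2 := Complex.norm_le_abs_re_add_abs_im (inner ℂ e v)
      rw [hin] at h2 h1
      simp only at h2
      have h3 : 2 * (η * δ) ≤ κ * δ := by
        rw [← hηL]; nlinarith [mul_pos hη0 hδ0]
      linarith
    · have hsq : (η * δ) ^ 2 ≤ η ^ 2 * δ := by
        rw [mul_pow]; gcongr; nlinarith
      have hx' : (Φ v).2 ^ 2 ≤ η ^ 2 * δ := by
        rw [← sq_abs]; exact (pow_le_pow_left₀ (abs_nonneg _) hx.le 2).trans hsq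
      have hy' : (Φ v).1.1 ^ 2 ≤ η ^ 2 * δ := by
        rw [← sq_abs]; exact (pow_le_pow_left₀ (abs_nonneg _) hy.le 2).trans hsq
      have hz' : ∑ i, ‖(Φ v).1.2 i‖ ^ 2 ≤ m * (η ^ 2 * δ) := by
        have : ∀ i ∈ Finset.univ, ‖(Φ v).1.2 i‖ ^ 2 ≤ η ^ 2 * δ := fun i _ => by
          have := hz i (Set.mem_univ i)
          rw [mem_ball_zero_iff] at this
          have := pow_le_pow_left₀ (norm_nonneg _) this.le 2
          rwa [mul_pow, Real.sq_sqrt hδ0.le] at this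
        have := Finset.sum_le_card_nsmul _ _ _ this
        simpa using this
      have h4 : L * (η ^ 2 * δ) < κ ^ 2 * δ := by
        rw [← hηL]
        have : 0 < η ^ 2 * δ := by positivity
        nlinarith
      rw [hn]
      rw [hL] at h4
      linarith
  rw [htr, mul_assoc, ← hvS]
  calc C * volume S = C * ∫⁻ x, S.indicator 1 x := by rw [lintegral_indicator_one hS]
    _ = ∫⁻ v, S.indicator 1 (Φ v) := (hΦ _).symm
    _ ≤ ∫⁻ v, Set.indicator {v : EuclideanSpace ℂ (Fin (m + 1)) |
        ‖inner ℂ a v‖ < κ * (1 - ‖a‖ ^ 2) ∧ ‖v‖ ^ 2 < κ ^ 2 * (1 - ‖a‖ ^ 2)} 1 v := by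
        refine lintegral_mono fun v => ?_
        by_cases hv : Φ v ∈ S
        · rw [Set.indicator_of_mem hv, Set.indicator_of_mem (hsub v hv)]
          rfl
        · rw [Set.indicator_of_notMem hv]; exact zero_le
    _ ≤ _ := lintegral_indicator_one_le _

/-! ### Kernel sums over separated sequences -/

/-- At κ = 0 the inequality reads θ < 1, so it persists for small κ. It is exactly what contradicts
the overlap estimate for two separated points. -/
lemma exists_nhd_size_of_lt_one {θ : ℝ} (hθ : θ < 1) :
    ∃ κ : ℝ, 0 < κ ∧ κ ≤ 1 / 16 ∧ θ * (1 + 2 * κ) ^ 2 < (1 - 4 * κ) ^ 4 := by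
  have hcont : Continuous fun κ : ℝ => (1 - 4 * κ) ^ 4 - θ * (1 + 2 * κ) ^ 2 := by fun_prop
  have h0 : ∀ᶠ κ in nhds (0 : ℝ), 0 < (1 - 4 * κ) ^ 4 - θ * (1 + 2 * κ) ^ 2 := by
    apply hcont.continuousAt.eventually_const_lt
    norm_num
    exact hθ
  have h1 : ∀ᶠ κ in nhdsWithin (0 : ℝ) (Set.Ioi 0), κ ∈ Set.Ioo (0 : ℝ) (1 / 16) :=
    Ioo_mem_nhdsGT (by norm_num)
  obtain ⟨κ, hκ, hκ'⟩ := ((h0.filter_mono nhdsWithin_le_nhds).and h1).exists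
  exact ⟨κ, hκ'.1, hκ'.2.le, by linarith⟩

lemma two_rpow_neg_abs_mul_le {x y c : ℝ} (hx : 0 < x) (hy : 0 < y) (h1 : x ≤ 2 * y)
    (h2 : y ≤ 2 * x) : 2 ^ (-|c|) * x ^ c ≤ y ^ c := by
  rw [Real.rpow_neg zero_le_two, inv_mul_le_iff₀ (by positivity)]
  rcases le_total 0 c with hc | hc
  · rw [abs_of_nonneg hc, ← Real.mul_rpow zero_le_two hy.le]
    exact Real.rpow_le_rpow hx.le h1 hc
  · rw [abs_of_nonpos hc, Real.rpow_neg zero_le_two, ← div_eq_inv_mul, le_div_iff₀ (by positivity),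
      mul_comm, ← Real.mul_rpow zero_le_two hx.le]
    exact Real.rpow_le_rpow_of_nonpos hy h2 hc

/-- For a separated sequence, the sum of kernel values obeys the Forelli–Rudin bound. -/
lemma exists_tsum_kernel_le (m : ℕ) {c d θ : ℝ} (hc : -1 < c) (hd : 0 < d) (hθ : θ < 1)
    {a : ℕ → EuclideanSpace ℂ (Fin (m + 1))} (ha : ∀ k, a k ∈ unitBall (m + 1))
    (hsep : ∀ j k, j ≠ k →
      (1 - ‖a j‖ ^ 2) * (1 - ‖a k‖ ^ 2) ≤ θ * ‖1 - inner ℂ (a j) (a k)‖ ^ 2) :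
    ∃ C : ENNReal, C ≠ ⊤ ∧ ∀ z ∈ unitBall (m + 1),
      ∑' j, ENNReal.ofReal ((1 - ‖a j‖ ^ 2) ^ ((m : ℝ) + 2 + c) /
        ‖1 - inner ℂ z (a j)‖ ^ ((m : ℝ) + 2 + c + d)) ≤
        C * ENNReal.ofReal ((1 - ‖z‖ ^ 2) ^ (-d)) := by
  obtain ⟨κ, hκ, hκ1, hκθ⟩ := exists_nhd_size_of_lt_one hθ
  obtain ⟨C₁, hC₁, hFR⟩ := exists_lintegral_forelliRudin_le m hc hd
  obtain ⟨C₂, hC₂, hvol⟩ := exists_le_volume_nonisotropicNhd m hκ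
  set N : ℝ := (m : ℝ) + 2 + c + d with hN
  have hN0 : 0 < N := by
    have : (0 : ℝ) ≤ m := m.cast_nonneg
    linarith
  have hdisj : Pairwise (Function.onFun Disjoint fun j => nonisotropicNhd κ (a j)) := by
    intro j k hjk
    refine Set.disjoint_left.2 fun w hj hk => ?_
    have h := norm_one_sub_inner_sq_le_of_overlap hκ hκ1 (ha j) (ha k) hj hk
    have hX := norm_one_sub_inner_pos (ha j) (ha k)
    have h2 := mul_le_mul_of_nonneg_left (hsep j k hjk) (sq_nonneg (1 + 2 * κ))
    nlinarith [pow_pos hX 2]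
  set K : ℝ := 2 ^ (-|c|) * 2 ^ (-N) with hK
  have hK0 : 0 < K := by positivity
  have hterm : ∀ z ∈ unitBall (m + 1), ∀ j, C₂ * ENNReal.ofReal K *
      ENNReal.ofReal ((1 - ‖a j‖ ^ 2) ^ ((m : ℝ) + 2 + c) / ‖1 - inner ℂ z (a j)‖ ^ N) ≤
      ∫⁻ w in nonisotropicNhd κ (a j),
        ENNReal.ofReal ((1 - ‖w‖ ^ 2) ^ c / ‖1 - inner ℂ z w‖ ^ N) := by
    intro z hz j
    have hδ := one_sub_norm_sq_pos (ha j)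
    have hX := norm_one_sub_inner_pos hz (ha j)
    have hpt : ∀ w ∈ nonisotropicNhd κ (a j),
        ENNReal.ofReal (K * ((1 - ‖a j‖ ^ 2) ^ c / ‖1 - inner ℂ z (a j)‖ ^ N)) ≤
          ENNReal.ofReal ((1 - ‖w‖ ^ 2) ^ c / ‖1 - inner ℂ z w‖ ^ N) := by
      intro w hw
      have hwB := mem_unitBall_of_mem_nonisotropicNhd hκ hκ1 (ha j) hw
      have hδw := one_sub_norm_sq_pos hwB
      have hXw := norm_one_sub_inner_pos hz hwB
      apply ENNReal.ofReal_le_ofReal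
      have hκ2 : 1 / 2 ≤ 1 - 2 * κ - κ ^ 2 := by nlinarith
      have h1 : 2 ^ (-|c|) * (1 - ‖a j‖ ^ 2) ^ c ≤ (1 - ‖w‖ ^ 2) ^ c := by
        apply two_rpow_neg_abs_mul_le hδ hδw
        · nlinarith [le_one_sub_norm_sq_of_mem hw, mul_le_mul_of_nonneg_right hκ2 hδ.le]
        · nlinarith [one_sub_norm_sq_le_of_mem hw]
      have h2 : ‖1 - inner ℂ z w‖ ^ N ≤ 2 ^ N * ‖1 - inner ℂ z (a j)‖ ^ N := by
        rw [← Real.mul_rpow zero_le_two hX.le]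
        refine Real.rpow_le_rpow hXw.le ?_ hN0.le
        nlinarith [norm_one_sub_inner_le_of_mem hκ (ha j) hz hw]
      calc K * ((1 - ‖a j‖ ^ 2) ^ c / ‖1 - inner ℂ z (a j)‖ ^ N)
          = (2 ^ (-|c|) * (1 - ‖a j‖ ^ 2) ^ c) / (2 ^ N * ‖1 - inner ℂ z (a j)‖ ^ N) := by
            rw [hK, Real.rpow_neg zero_le_two N]
            field_simp
        _ ≤ (1 - ‖w‖ ^ 2) ^ c / ‖1 - inner ℂ z w‖ ^ N := by gcongr
    refine le_trans ?_ (setLIntegral_mono' (measurableSet_nonisotropicNhd κ (a j)) hpt)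
    rw [setLIntegral_const]
    refine le_trans ?_ (mul_le_mul_right (hvol _ (ha j)) _)
    rw [mul_left_comm, mul_assoc C₂, ← ENNReal.ofReal_mul hK0.le,
      ← ENNReal.ofReal_mul (by positivity)]
    apply le_of_eq
    congr 2
    rw [show (m : ℝ) + 2 + c = c + ((m + 2 : ℕ) : ℝ) by push_cast; ring, Real.rpow_add hδ,
      Real.rpow_natCast]
    ring
  refine ⟨(C₂ * ENNReal.ofReal K)⁻¹ * C₁, ENNReal.mul_ne_top (ENNReal.inv_ne_top.2
    (mul_ne_zero hC₂ (by rwa [Ne, ENNReal.ofReal_eq_zero, not_le]))) hC₁, fun z hz => ?_⟩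
  -- Finiteness of `C₂` is needed to divide by it; it is read off from the volume bound at the
  -- centre 0.
  have hC₂t : C₂ ≠ ⊤ := by
    have h := (hvol 0 (by simp [unitBall])).trans_lt ((measure_mono
      fun w hw => mem_unitBall_of_mem_nonisotropicNhd hκ hκ1 (by simp [unitBall]) hw).trans_lt
        (measure_ball_lt_top (μ := volume)
          (x := (0 : EuclideanSpace ℂ (Fin (m + 1)))) (r := 1)))
    simp only [norm_zero] at h
    rintro rfl
    norm_num at h
  rw [mul_assoc, ← ENNReal.mul_le_iff_le_inv
    (mul_ne_zero hC₂ (by rwa [Ne, ENNReal.ofReal_eq_zero, not_le]))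
    (ENNReal.mul_ne_top hC₂t ENNReal.ofReal_ne_top), ← ENNReal.tsum_mul_left]
  refine (ENNReal.tsum_le_tsum (hterm z hz)).trans ?_
  rw [← lintegral_iUnion (fun j => measurableSet_nonisotropicNhd κ (a j)) hdisj]
  refine (lintegral_mono_set ?_).trans (hFR z hz)
  exact Set.iUnion_subset fun j w hw => mem_unitBall_of_mem_nonisotropicNhd hκ hκ1 (ha j) hw

/-! ### Hölder and Schur arguments in ℓ^p and weighted L^p -/

/-- Hölder's inequality for the measure with weights A, raised to the power p. -/
lemma ENNReal.tsum_mul_rpow_le {ι : Type*} (A x : ι → ENNReal) {p : ℝ} (hp : 1 ≤ p) :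
    (∑' i, A i * x i) ^ p ≤ (∑' i, A i) ^ (p - 1) * ∑' i, A i * x i ^ p := by
  have hp0 : 0 < p := by linarith
  have hp1 : 0 ≤ 1 - p⁻¹ := by
    have := inv_le_one_of_one_le₀ hp
    linarith
  have h : ∑' i, A i * x i ≤ (∑' i, A i) ^ (1 - p⁻¹) * (∑' i, A i * x i ^ p) ^ p⁻¹ := by
    rw [ENNReal.tsum_eq_iSup_sum]
    refine iSup_le fun s => (ENNReal.inner_le_weight_mul_Lp_of_nonneg s hp A x).trans ?_
    gcongr
    · exact ENNReal.sum_le_tsum s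
    · exact ENNReal.sum_le_tsum s
  refine (ENNReal.rpow_le_rpow h hp0.le).trans ?_
  rw [ENNReal.mul_rpow_of_nonneg _ _ hp0.le, ← ENNReal.rpow_mul, ← ENNReal.rpow_mul,
    inv_mul_cancel₀ hp0.ne', ENNReal.rpow_one, sub_mul, one_mul, inv_mul_cancel₀ hp0.ne']

/-- Atomic synthesis: kernels along a separated sequence map `ℓ^p` into weighted `L^p`. -/
lemma lintegral_tsum_kernel_rpow_lt_top (m : ℕ) {p γ θ : ℝ} (hp : 1 < p) (hγ : -1 < γ)
    (hθ : θ < 1) {a : ℕ → EuclideanSpace ℂ (Fin (m + 1))} (ha : ∀ k, a k ∈ unitBall (m + 1))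
    (hsep : ∀ j k, j ≠ k →
      (1 - ‖a j‖ ^ 2) * (1 - ‖a k‖ ^ 2) ≤ θ * ‖1 - inner ℂ (a j) (a k)‖ ^ 2)
    {N : ℝ} (hN : N = (m : ℝ) + 2 + γ) {x : ℕ → ENNReal} (hx : ∑' j, x j ^ p < ⊤) :
    ∫⁻ z in unitBall (m + 1), ENNReal.ofReal ((1 - ‖z‖ ^ 2) ^ γ) *
      (∑' j, x j * ENNReal.ofReal ((1 - ‖a j‖ ^ 2) ^ (N - N / p) /
        ‖1 - inner ℂ (a j) z‖ ^ N)) ^ p < ⊤ := by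
  have hp0 : 0 < p := by linarith
  -- The auxiliary exponent of the Schur test: εp = (1+γ)/2 keeps both γ-ε and γ-ε(p-1) above -1, so
  -- the kernel-sum bound and the Forelli–Rudin estimate both apply.
  set ε : ℝ := (1 + γ) / (2 * p) with hε
  have hε0 : 0 < ε := div_pos (by linarith) (by linarith)
  have hεp : ε * p = (1 + γ) / 2 := by rw [hε]; field_simp
  have hεp' : ε < ε * p := by nlinarith
  obtain ⟨C₁, hC₁, hsum⟩ := exists_tsum_kernel_le m (c := γ - ε) (by linarith) hε0 hθ ha hsep
  obtain ⟨C₂, hC₂, hint⟩ := exists_lintegral_forelliRudin_le m (c := γ - ε * (p - 1))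
    (d := ε * (p - 1)) (by nlinarith) (mul_pos hε0 (by linarith))
  rw [show (m : ℝ) + 2 + (γ - ε * (p - 1)) + ε * (p - 1) = N by rw [hN]; ring] at hint
  rw [show (m : ℝ) + 2 + (γ - ε) + ε = N by rw [hN]; ring,
    show (m : ℝ) + 2 + (γ - ε) = N - ε by rw [hN]; ring] at hsum
  let A : ℕ → EuclideanSpace ℂ (Fin (m + 1)) → ENNReal := fun j z =>
    ENNReal.ofReal ((1 - ‖a j‖ ^ 2) ^ (N - ε) / ‖1 - inner ℂ z (a j)‖ ^ N)
  let y : ℕ → ENNReal := fun j => x j * ENNReal.ofReal ((1 - ‖a j‖ ^ 2) ^ (ε - N / p))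
  let G : ℕ → EuclideanSpace ℂ (Fin (m + 1)) → ENNReal := fun j z =>
    ENNReal.ofReal ((1 - ‖z‖ ^ 2) ^ (γ - ε * (p - 1)) / ‖1 - inner ℂ (a j) z‖ ^ N)
  have hG : ∀ j, Measurable (G j) := fun j => by fun_prop
  have hδ : ∀ j, 0 < 1 - ‖a j‖ ^ 2 := fun j => one_sub_norm_sq_pos (ha j)
  have hpt : ∀ z ∈ unitBall (m + 1), ENNReal.ofReal ((1 - ‖z‖ ^ 2) ^ γ) *
      (∑' j, x j * ENNReal.ofReal ((1 - ‖a j‖ ^ 2) ^ (N - N / p) /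
        ‖1 - inner ℂ (a j) z‖ ^ N)) ^ p ≤
      C₁ ^ (p - 1) * ∑' j, y j ^ p * ENNReal.ofReal ((1 - ‖a j‖ ^ 2) ^ (N - ε)) * G j z := by
    intro z hz
    have hz0 := one_sub_norm_sq_pos hz
    -- A power (1-|a_j|²)^(ε-N/p) moves from the kernel to the coefficient. The weights A then sum
    -- to O((1-|z|²)^(-ε)), and all powers of 1-|a_j|² cancel after integration in z.
    have h1 : ∀ j, x j * ENNReal.ofReal ((1 - ‖a j‖ ^ 2) ^ (N - N / p) /
        ‖1 - inner ℂ (a j) z‖ ^ N) = A j z * y j := by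
      intro j
      simp only [A, y]
      rw [mul_left_comm, ← ENNReal.ofReal_mul (by have := hδ j; positivity),
        norm_one_sub_inner_comm (a j) z, div_mul_eq_mul_div, ← Real.rpow_add (hδ j)]
      congr 4
      ring
    simp_rw [h1]
    refine (mul_le_mul_right (ENNReal.tsum_mul_rpow_le (fun j => A j z) y hp.le) _).trans ?_
    have h2 : (∑' j, A j z) ^ (p - 1) ≤
        C₁ ^ (p - 1) * ENNReal.ofReal ((1 - ‖z‖ ^ 2) ^ (-(ε * (p - 1)))) := by
      refine (ENNReal.rpow_le_rpow (hsum z hz) (by linarith)).trans ?_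
      rw [ENNReal.mul_rpow_of_nonneg _ _ (by linarith), ENNReal.ofReal_rpow_of_pos (by positivity),
        ← Real.rpow_mul hz0.le, neg_mul]
    refine (mul_le_mul_right (mul_le_mul_left h2 _) _).trans ?_
    rw [mul_assoc (C₁ ^ (p - 1)), mul_left_comm, ← mul_assoc (ENNReal.ofReal _),
      ← ENNReal.ofReal_mul (by positivity), ← Real.rpow_add hz0, ← ENNReal.tsum_mul_left]
    refine mul_le_mul_right (ENNReal.tsum_le_tsum fun j => le_of_eq ?_) _
    simp only [A, G]
    rw [mul_comm (_ * _) (ENNReal.ofReal (_ / _)), mul_comm _ (y j ^ p),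
      mul_left_comm (ENNReal.ofReal _) (y j ^ p), mul_left_comm (ENNReal.ofReal _) (y j ^ p),
      ← ENNReal.ofReal_mul (by positivity), ← ENNReal.ofReal_mul (by positivity),
      norm_one_sub_inner_comm z, ← sub_eq_add_neg]
    congr 2
    ring
  have hterm : ∀ j, y j ^ p * ENNReal.ofReal ((1 - ‖a j‖ ^ 2) ^ (N - ε)) *
      ∫⁻ z in unitBall (m + 1), G j z ≤ C₂ * x j ^ p := by
    intro j
    refine (mul_le_mul_right (hint _ (ha j)) _).trans (le_of_eq ?_)
    simp only [y]
    have hj := hδ j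
    rw [ENNReal.mul_rpow_of_nonneg _ _ hp0.le, ENNReal.ofReal_rpow_of_pos (by positivity),
      ← Real.rpow_mul hj.le, mul_assoc (x j ^ p), ← ENNReal.ofReal_mul (by positivity),
      mul_left_comm _ C₂, mul_assoc (x j ^ p), ← ENNReal.ofReal_mul (by positivity),
      ← Real.rpow_add hj, ← Real.rpow_add hj]
    have : (ε - N / p) * p + (N - ε) + -(ε * (p - 1)) = 0 := by field_simp; ring
    rw [this, Real.rpow_zero, ENNReal.ofReal_one, mul_one]
  calc _ ≤ ∫⁻ z in unitBall (m + 1), C₁ ^ (p - 1) *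
        ∑' j, y j ^ p * ENNReal.ofReal ((1 - ‖a j‖ ^ 2) ^ (N - ε)) * G j z :=
        setLIntegral_mono' measurableSet_ball hpt
    _ = C₁ ^ (p - 1) * ∑' j, y j ^ p * ENNReal.ofReal ((1 - ‖a j‖ ^ 2) ^ (N - ε)) *
        ∫⁻ z in unitBall (m + 1), G j z := by
        rw [lintegral_const_mul' _ _ (ENNReal.rpow_ne_top_of_nonneg (by linarith) hC₁),
          lintegral_tsum fun j => ((hG j).const_mul _).aemeasurable]
        simp_rw [lintegral_const_mul _ (hG _)]
    _ ≤ C₁ ^ (p - 1) * (C₂ * ∑' j, x j ^ p) := by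
        have h := ENNReal.tsum_le_tsum hterm
        rw [ENNReal.tsum_mul_left] at h
        exact mul_le_mul_right h _
    _ < ⊤ := ENNReal.mul_lt_top (ENNReal.rpow_lt_top_of_nonneg (by linarith) hC₁)
        (ENNReal.mul_lt_top hC₂.lt_top hx)

/-- Schur's test for infinite matrices on `ℓ^p`. -/
lemma ENNReal.tsum_tsum_mul_rpow_le {p : ℝ} (hp : 1 < p) {M : ℕ → ℕ → ENNReal} {B₁ B₂ : ENNReal}
    (hrow : ∀ k, ∑' j, M k j ≤ B₁) (hcol : ∀ j, ∑' k, M k j ≤ B₂) (x : ℕ → ENNReal) :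
    ∑' k, (∑' j, M k j * x j) ^ p ≤ B₁ ^ (p - 1) * B₂ * ∑' j, x j ^ p := by
  calc ∑' k, (∑' j, M k j * x j) ^ p
      ≤ ∑' k, B₁ ^ (p - 1) * ∑' j, M k j * x j ^ p := by
        refine ENNReal.tsum_le_tsum fun k => ?_
        refine (ENNReal.tsum_mul_rpow_le _ _ hp.le).trans ?_
        gcongr
        exact hrow k
    _ = B₁ ^ (p - 1) * ∑' j, ∑' k, M k j * x j ^ p := by
        rw [ENNReal.tsum_mul_left, ENNReal.tsum_comm]
    _ ≤ B₁ ^ (p - 1) * ∑' j, B₂ * x j ^ p := by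
        refine mul_le_mul_right (ENNReal.tsum_le_tsum fun j => ?_) _
        rw [ENNReal.tsum_mul_right]
        exact mul_le_mul_left (hcol j) _
    _ = _ := by rw [ENNReal.tsum_mul_left, mul_assoc]

lemma enorm_rpow_eq_ofReal (z : ℂ) {p : ℝ} (hp : 0 < p) :
    ‖z‖ₑ ^ p = ENNReal.ofReal (‖z‖ ^ p) := by
  rw [← ofReal_norm, ENNReal.ofReal_rpow_of_nonneg (norm_nonneg z) hp.le]

lemma tsum_enorm_rpow_lt_top_iff (f : ℕ → ℂ) {p : ℝ} (hp : 0 < p) :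
    ∑' i, ‖f i‖ₑ ^ p < ⊤ ↔ Summable fun i => ‖f i‖ ^ p := by
  simp_rw [enorm_rpow_eq_ofReal _ hp]
  rw [← tsum_enorm_ne_top_iff_summable_norm.trans
    (by simp only [Real.norm_of_nonneg (Real.rpow_nonneg (norm_nonneg _) p)] :
      (Summable fun i => ‖(‖f i‖ ^ p : ℝ)‖) ↔ Summable fun i => ‖f i‖ ^ p), lt_top_iff_ne_top]
  simp_rw [Real.enorm_of_nonneg (Real.rpow_nonneg (norm_nonneg _) p)]

lemma lp_tsum_enorm_rpow {p : ℝ} (hp : 0 < p) (f : lp (fun _ : ℕ => ℂ) (ENNReal.ofReal p)) :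
    ∑' i, ‖f i‖ₑ ^ p = ENNReal.ofReal (‖f‖ ^ p) := by
  have hpr : (ENNReal.ofReal p).toReal = p := ENNReal.toReal_ofReal hp.le
  have h := lp.norm_rpow_eq_tsum (p := ENNReal.ofReal p) (by rw [hpr]; exact hp) f
  have h2 := (lp.memℓp f).summable (by rw [hpr]; exact hp)
  rw [hpr] at h h2
  rw [h, ENNReal.ofReal_tsum_of_nonneg (fun i => Real.rpow_nonneg (norm_nonneg _) p) h2]
  simp_rw [enorm_rpow_eq_ofReal _ hp]

/-- A small perturbation of the identity on `ℓ^p`, given by a matrix, is onto. -/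
lemma exists_add_tsum_mul_eq {p c : ℝ} (hp : 1 < p) (hc0 : 0 ≤ c) (hc : c < 1) (M : ℕ → ℕ → ℂ)
    (hM : ∀ x : ℕ → ENNReal,
      ∑' k, (∑' j, ‖M k j‖ₑ * x j) ^ p ≤ ENNReal.ofReal (c ^ p) * ∑' j, x j ^ p)
    (v : ℕ → ℂ) (hv : ∑' k, ‖v k‖ₑ ^ p < ⊤) :
    ∃ u : ℕ → ℂ, ∑' k, ‖u k‖ₑ ^ p < ⊤ ∧ ∀ k, u k + ∑' j, M k j * u j = v k := by
  have hp0 : 0 < p := by linarith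
  have : Fact (1 ≤ ENNReal.ofReal p) := ⟨ENNReal.one_le_ofReal.2 hp.le⟩
  have hpr : (ENNReal.ofReal p).toReal = p := ENNReal.toReal_ofReal hp0.le
  have hmem : ∀ f : ℕ → ℂ, Memℓp f (ENNReal.ofReal p) ↔ ∑' k, ‖f k‖ₑ ^ p < ⊤ := fun f => by
    rw [memℓp_gen_iff (by rw [hpr]; exact hp0), hpr, tsum_enorm_rpow_lt_top_iff f hp0]
  have hfin : ∀ f : ℕ → ℂ, ∑' k, ‖f k‖ₑ ^ p < ⊤ →
      ∑' k, (∑' j, ‖M k j‖ₑ * ‖f j‖ₑ) ^ p < ⊤ := fun f hf =>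
    (hM _).trans_lt (ENNReal.mul_lt_top ENNReal.ofReal_lt_top hf)
  have hs : ∀ f : ℕ → ℂ, ∑' k, ‖f k‖ₑ ^ p < ⊤ → ∀ k, Summable fun j => M k j * f j := by
    intro f hf k
    refine Summable.of_norm (tsum_enorm_ne_top_iff_summable_norm.1 ?_)
    simp_rw [enorm_mul]
    have h := (ENNReal.le_tsum (f := fun k => (∑' j, ‖M k j‖ₑ * ‖f j‖ₑ) ^ p) k).trans_lt (hfin f hf)
    exact ((ENNReal.rpow_lt_top_iff_of_pos hp0).1 h).ne
  have hle : ∀ f : ℕ → ℂ, ∑' k, ‖∑' j, M k j * f j‖ₑ ^ p ≤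
      ∑' k, (∑' j, ‖M k j‖ₑ * ‖f j‖ₑ) ^ p := by
    intro f
    refine ENNReal.tsum_le_tsum fun k => ENNReal.rpow_le_rpow ?_ hp0.le
    refine enorm_tsum_le_tsum_enorm.trans (le_of_eq ?_)
    simp_rw [enorm_mul]
  let T : lp (fun _ : ℕ => ℂ) (ENNReal.ofReal p) →ₗ[ℂ] lp (fun _ : ℕ => ℂ) (ENNReal.ofReal p) :=
    { toFun := fun f => ⟨fun k => ∑' j, M k j * f j,
        (hmem _).2 ((hle f).trans_lt (hfin f ((hmem f).1 (lp.memℓp f))))⟩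
      map_add' := fun f g => by
        ext k
        have hf := hs f ((hmem f).1 (lp.memℓp f)) k
        have hg := hs g ((hmem g).1 (lp.memℓp g)) k
        change ∑' j, M k j * (f j + g j) = ∑' j, M k j * f j + ∑' j, M k j * g j
        rw [← hf.tsum_add hg]
        simp_rw [mul_add]
      map_smul' := fun r f => by
        ext k
        change ∑' j, M k j * (r * f j) = r * ∑' j, M k j * f j
        rw [← tsum_mul_left]
        simp_rw [mul_left_comm] }
  have hTb : ∀ f, ‖T f‖ ≤ c * ‖f‖ := by
    intro f
    have h := (hle f).trans (hM fun j => ‖f j‖ₑ)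
    have h2 : ∑' k, ‖(T f) k‖ₑ ^ p ≤ ENNReal.ofReal (c ^ p) * ∑' j, ‖f j‖ₑ ^ p := h
    rw [lp_tsum_enorm_rpow hp0, lp_tsum_enorm_rpow hp0, ← ENNReal.ofReal_mul (by positivity),
      ← Real.mul_rpow hc0 (norm_nonneg _), ENNReal.ofReal_le_ofReal_iff (by positivity)] at h2
    exact (Real.rpow_le_rpow_iff (norm_nonneg _) (by positivity) hp0).1 h2
  let T' := T.mkContinuous c hTb
  have hT' : ‖-T'‖ < 1 := by
    rw [norm_neg]
    exact (T.mkContinuous_norm_le hc0 hTb).trans_lt hc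
  obtain ⟨W, hW⟩ := (isUnit_one_sub_of_norm_lt_one hT').exists_right_inv
  let v' : lp (fun _ : ℕ => ℂ) (ENNReal.ofReal p) := ⟨v, (hmem v).2 hv⟩
  have hsol : (W v') + T' (W v') = v' := by
    have := congrArg (fun S => S v') hW
    simpa using this
  refine ⟨W v', (hmem _).1 (lp.memℓp _), fun k => ?_⟩
  exact congrArg (fun f : lp (fun _ : ℕ => ℂ) (ENNReal.ofReal p) => f k) hsol

/-! ### Kernels and holomorphy of their series -/

/-- The kernel `(1 - ⟨a, z⟩)^(-N)`. -/
noncomputable def bergmanKernel {n : ℕ} (N : ℝ) (a z : EuclideanSpace ℂ (Fin n)) : ℂ :=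
  (1 - inner ℂ a z) ^ (((-N : ℝ)) : ℂ)

section bergmanKernel

variable {n : ℕ} {N : ℝ} {a z : EuclideanSpace ℂ (Fin n)}

lemma norm_bergmanKernel (N : ℝ) (a z : EuclideanSpace ℂ (Fin n)) :
    ‖bergmanKernel N a z‖ = (‖1 - inner ℂ a z‖ ^ N)⁻¹ := by
  rw [bergmanKernel, Complex.norm_cpow_real, Real.rpow_neg (norm_nonneg _)]

lemma bergmanKernel_self (N : ℝ) (ha : a ∈ unitBall n) :
    bergmanKernel N a a = (((1 - ‖a‖ ^ 2) ^ (-N) : ℝ) : ℂ) := by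
  rw [bergmanKernel, inner_self_eq_norm_sq_to_K, Complex.ofReal_cpow (one_sub_norm_sq_pos ha).le]
  push_cast
  rfl

lemma one_sub_norm_le_norm_one_sub_inner (ha : a ∈ unitBall n) (z : EuclideanSpace ℂ (Fin n)) :
    1 - ‖z‖ ≤ (1 - inner ℂ a z).re := by
  have ha1 : ‖a‖ < 1 := by simpa [unitBall] using ha
  have h1 := Complex.re_le_norm (inner ℂ a z)
  have h2 := norm_inner_le_norm (𝕜 := ℂ) a z
  rw [Complex.sub_re, Complex.one_re]
  nlinarith [norm_nonneg a, norm_nonneg z]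

lemma hasFDerivAt_bergmanKernel (N : ℝ) (ha : a ∈ unitBall n) (hz : z ∈ unitBall n) :
    HasFDerivAt (bergmanKernel N a)
      (((((-N : ℝ)) : ℂ) * (1 - inner ℂ a z) ^ ((((-N : ℝ)) : ℂ) - 1)) • -(innerSL ℂ a)) z := by
  have hz1 : ‖z‖ < 1 := by simpa [unitBall] using hz
  have hs : 1 - inner ℂ a z ∈ Complex.slitPlane := by
    left
    linarith [one_sub_norm_le_norm_one_sub_inner ha z]
  have h1 : HasFDerivAt (fun z => 1 - inner ℂ a z) (-(innerSL ℂ a)) z :=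
    (innerSL ℂ a).hasFDerivAt.const_sub 1
  have h2 := (hasDerivAt_id (1 - inner ℂ a z)).cpow_const (c := (((-N : ℝ)) : ℂ)) hs
  rw [mul_one] at h2
  exact h2.comp_hasFDerivAt z h1

lemma norm_fderiv_bergmanKernel_le {ρ : ℝ} (hN : 0 < N) (ha : a ∈ unitBall n) (hρ : ρ < 1)
    (hz : ‖z‖ < ρ) :
    ‖((((-N : ℝ)) : ℂ) * (1 - inner ℂ a z) ^ ((((-N : ℝ)) : ℂ) - 1)) • -(innerSL ℂ a)‖ ≤
      N * (1 - ρ) ^ (-N - 1) := by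
  have ha1 : ‖a‖ < 1 := by simpa [unitBall] using ha
  have h1 : 1 - ρ ≤ ‖1 - inner ℂ a z‖ := by
    linarith [one_sub_norm_le_norm_one_sub_inner ha z, Complex.re_le_norm (1 - inner ℂ a z)]
  rw [norm_smul, norm_neg, innerSL_apply_norm, norm_mul, Complex.norm_real, norm_neg,
    Real.norm_of_nonneg hN.le, ← Complex.ofReal_one, ← Complex.ofReal_sub, Complex.norm_cpow_real,
    Complex.ofReal_one]
  have h2 : ‖1 - inner ℂ a z‖ ^ (-N - 1) ≤ (1 - ρ) ^ (-N - 1) :=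
    Real.rpow_le_rpow_of_nonpos (by linarith) h1 (by linarith)
  have h3 : 0 ≤ ‖1 - inner ℂ a z‖ ^ (-N - 1) := by positivity
  have h4 := mul_le_mul_of_nonneg_left h2 hN.le
  have h5 : 0 ≤ N * ‖1 - inner ℂ a z‖ ^ (-N - 1) := by positivity
  nlinarith [norm_nonneg a]

end bergmanKernel

lemma summable_mul_bergmanKernel {n : ℕ} {N : ℝ} (hN : 0 < N) {a : ℕ → EuclideanSpace ℂ (Fin n)}
    (ha : ∀ k, a k ∈ unitBall n) {c : ℕ → ℂ} (hc : Summable fun j => ‖c j‖)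
    {z : EuclideanSpace ℂ (Fin n)} (hz : z ∈ unitBall n) :
    Summable fun j => c j * bergmanKernel N (a j) z := by
  have hz1 : ‖z‖ < 1 := by simpa [unitBall] using hz
  refine Summable.of_norm_bounded (hc.mul_right ((1 - ‖z‖) ^ (-N))) fun j => ?_
  rw [norm_mul, bergmanKernel, Complex.norm_cpow_real]
  refine mul_le_mul_of_nonneg_left (Real.rpow_le_rpow_of_nonpos (by linarith) ?_ (by linarith))
    (norm_nonneg _)
  linarith [one_sub_norm_le_norm_one_sub_inner (ha j) z,
    Complex.re_le_norm (1 - inner ℂ (a j) z)]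

/-- On |z| < ρ < 1 the derivatives of the kernels are bounded uniformly in the pole, so ℓ¹
coefficients allow termwise differentiation. -/
lemma differentiableOn_tsum_mul_bergmanKernel {n : ℕ} {N : ℝ} (hN : 0 < N)
    {a : ℕ → EuclideanSpace ℂ (Fin n)} (ha : ∀ k, a k ∈ unitBall n) {c : ℕ → ℂ}
    (hc : Summable fun j => ‖c j‖) :
    DifferentiableOn ℂ (fun z => ∑' j, c j * bergmanKernel N (a j) z) (unitBall n) := by
  intro z hz
  have hz1 : ‖z‖ < 1 := by simpa [unitBall] using hz
  obtain ⟨ρ, hzρ, hρ⟩ := exists_between hz1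
  have hsub : ∀ w ∈ Metric.ball (0 : EuclideanSpace ℂ (Fin n)) ρ, w ∈ unitBall n := fun w hw =>
    Metric.ball_subset_ball hρ.le hw
  refine (hasFDerivAt_tsum_of_isPreconnected
    (hc.mul_right (N * (1 - ρ) ^ (-N - 1))) Metric.isOpen_ball
    (convex_ball (0 : EuclideanSpace ℂ (Fin n)) ρ).isPreconnected
    (fun j w hw => (hasFDerivAt_bergmanKernel N (ha j) (hsub w hw)).const_mul (c j))
    (fun j w hw => ?_) (x₀ := z) (by simpa using hzρ)
    (summable_mul_bergmanKernel hN ha hc hz)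
    (by simpa using hzρ)).differentiableAt.differentiableWithinAt
  rw [norm_smul]
  exact mul_le_mul_of_nonneg_left
    (norm_fderiv_bergmanKernel_le hN (ha j) hρ (by simpa using hw)) (norm_nonneg _)

/-! ### Separation from the bounds on K -/

lemma tsum_le_of_bergmanK_le {n : ℕ} {a : ℕ → EuclideanSpace ℂ (Fin n)} {s t : ℝ} {B : ENNReal}
    (h : bergmanK a s t ≤ B) (k : ℕ) :
    ∑' j, Set.indicator {j | j ≠ k} (fun j => ENNReal.ofReal ((1 - ‖a k‖ ^ 2) ^ s *
      (1 - ‖a j‖ ^ 2) ^ t / ‖1 - inner ℂ (a k) (a j)‖ ^ (s + t))) j ≤ B := by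
  rw [← tsum_subtype]
  exact (le_iSup (fun k : ℕ => ∑' j : {j : ℕ // j ≠ k},
    ENNReal.ofReal ((1 - ‖a k‖ ^ 2) ^ s * (1 - ‖a j‖ ^ 2) ^ t /
      ‖1 - inner ℂ (a k) (a j)‖ ^ (s + t))) k).trans h

lemma entry_le_of_bergmanK_le {n : ℕ} {a : ℕ → EuclideanSpace ℂ (Fin n)} {s t B : ℝ} (hB : 0 ≤ B)
    (h : bergmanK a s t ≤ ENNReal.ofReal B) {j k : ℕ} (hjk : j ≠ k) :
    (1 - ‖a k‖ ^ 2) ^ s * (1 - ‖a j‖ ^ 2) ^ t / ‖1 - inner ℂ (a k) (a j)‖ ^ (s + t) ≤ B := by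
  have h1 := (ENNReal.le_tsum j).trans (tsum_le_of_bergmanK_le h k)
  rw [Set.indicator_of_mem (show j ∈ {j | j ≠ k} from hjk)] at h1
  exact (ENNReal.ofReal_le_ofReal_iff hB).1 h1

/-- The two bounds on `K` force the sequence to be uniformly separated. -/
lemma exists_separation {n : ℕ} {a : ℕ → EuclideanSpace ℂ (Fin n)} (ha : ∀ k, a k ∈ unitBall n)
    {s t B₁ B₂ : ℝ} (hst : 0 < s + t) (hB₁ : 0 ≤ B₁) (hB₂ : 0 ≤ B₂) (hB : min B₁ B₂ < 1)
    (h₁ : bergmanK a s t ≤ ENNReal.ofReal B₁) (h₂ : bergmanK a t s ≤ ENNReal.ofReal B₂) :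
    ∃ θ < 1, ∀ j k, j ≠ k →
      (1 - ‖a j‖ ^ 2) * (1 - ‖a k‖ ^ 2) ≤ θ * ‖1 - inner ℂ (a j) (a k)‖ ^ 2 := by
  have hm : 0 ≤ min B₁ B₂ := le_min hB₁ hB₂
  have hent : ∀ j k, j ≠ k → (1 - ‖a k‖ ^ 2) ^ s * (1 - ‖a j‖ ^ 2) ^ t /
      ‖1 - inner ℂ (a k) (a j)‖ ^ (s + t) ≤ min B₁ B₂ := by
    intro j k hjk
    refine le_min (entry_le_of_bergmanK_le hB₁ h₁ hjk) ?_
    have := entry_le_of_bergmanK_le hB₂ h₂ hjk.symm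
    rwa [norm_one_sub_inner_comm, add_comm t s, mul_comm] at this
  refine ⟨(min B₁ B₂ ^ 2) ^ (s + t)⁻¹, Real.rpow_lt_one (by positivity) (by nlinarith)
    (by positivity), fun j k hjk => ?_⟩
  have hj := one_sub_norm_sq_pos (ha j)
  have hk := one_sub_norm_sq_pos (ha k)
  have hX := norm_one_sub_inner_pos (ha j) (ha k)
  rw [← div_le_iff₀ (by positivity)]
  -- Multiplying the (j,k) and (k,j) entries symmetrises the exponents: both factors 1-|a_j|² and
  -- 1-|a_k|² acquire the power s + t.
  have h3 := mul_le_mul (hent j k hjk) (hent k j hjk.symm) (by positivity) hm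
  rw [norm_one_sub_inner_comm (a k), ← sq (min B₁ B₂)] at h3
  have h4 : ((1 - ‖a j‖ ^ 2) * (1 - ‖a k‖ ^ 2) / ‖1 - inner ℂ (a j) (a k)‖ ^ 2) ^ (s + t) ≤
      min B₁ B₂ ^ 2 := by
    refine le_trans (le_of_eq ?_) h3
    rw [Real.div_rpow (by positivity) (by positivity), Real.mul_rpow hj.le hk.le,
      sq ‖1 - inner ℂ (a j) (a k)‖,
      Real.mul_rpow hX.le hX.le, Real.rpow_add hj, Real.rpow_add hk]
    field_simp
  have h5 := Real.rpow_le_rpow (by positivity) h4 (inv_nonneg.2 hst.le)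
  rwa [← Real.rpow_mul (by positivity), mul_inv_cancel₀ hst.ne', Real.rpow_one] at h5

/-! ### Synthesis in the Bergman space and solution of the interpolation problem -/

lemma memBergman_tsum_mul_bergmanKernel {m : ℕ} {p α θ N : ℝ} (hp : 1 < p) (hα : -1 < α * p)
    (hθ : θ < 1) {a : ℕ → EuclideanSpace ℂ (Fin (m + 1))} (ha : ∀ k, a k ∈ unitBall (m + 1))
    (hsep : ∀ j k, j ≠ k →
      (1 - ‖a j‖ ^ 2) * (1 - ‖a k‖ ^ 2) ≤ θ * ‖1 - inner ℂ (a j) (a k)‖ ^ 2)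
    (hN : N = (m : ℝ) + 2 + α * p) {u : ℕ → ℂ} (hu : ∑' j, ‖u j‖ₑ ^ p < ⊤)
    (hc : Summable fun j => ‖u j * (((1 - ‖a j‖ ^ 2) ^ (N - N / p) : ℝ) : ℂ)‖) :
    MemBergman (m + 1) p α (fun z => ∑' j,
      u j * (((1 - ‖a j‖ ^ 2) ^ (N - N / p) : ℝ) : ℂ) * bergmanKernel N (a j) z) := by
  have hp0 : 0 < p := by linarith
  have hN0 : 0 < N := by
    have : (0 : ℝ) ≤ m := m.cast_nonneg
    linarith
  refine ⟨differentiableOn_tsum_mul_bergmanKernel hN0 ha hc, ?_⟩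
  rw [ballMeasure, lintegral_smul_measure]
  refine ENNReal.mul_lt_top (ENNReal.inv_lt_top.2 (Metric.measure_ball_pos _ _ one_pos)) ?_
  refine lt_of_le_of_lt ?_ (lintegral_tsum_kernel_rpow_lt_top m hp hα hθ ha hsep hN hu)
  refine setLIntegral_mono' measurableSet_ball fun z hz => ?_
  have hz0 := one_sub_norm_sq_pos hz
  rw [ENNReal.ofReal_mul (by positivity), ← enorm_rpow_eq_ofReal _ hp0]
  refine mul_le_mul_right (ENNReal.rpow_le_rpow ?_ hp0.le) _
  refine enorm_tsum_le_tsum_enorm.trans (ENNReal.tsum_le_tsum fun j => le_of_eq ?_)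
  have hj := one_sub_norm_sq_pos (ha j)
  rw [enorm_mul, enorm_mul, mul_assoc]
  congr 1
  rw [← enorm_mul, ← ofReal_norm, norm_mul, norm_bergmanKernel, Complex.norm_real,
    Real.norm_of_nonneg (by positivity), ← div_eq_mul_inv]

theorem theorem4p5 (n : ℕ) (hn : 1 ≤ n) (p q α β : ℝ) (hp : 1 < p)
    (hpq : 1 / p + 1 / q = 1) (hα : -1 / p < α) (hβ : β = α * p / q)
    (a : ℕ → EuclideanSpace ℂ (Fin n)) (ha : ∀ k, a k ∈ unitBall n)
    (c₁ c₂ : ℝ) (hc₁ : 0 < c₁) (hc₂ : 0 < c₂) (hc : c₁ * c₂ < 1)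
    (hK₁ : bergmanK a (((n : ℝ) + 1) / p + α) (((n : ℝ) + 1) / q + β) ≤ ENNReal.ofReal (c₁ ^ q))
    (hK₂ : bergmanK a (((n : ℝ) + 1) / q + β) (((n : ℝ) + 1) / p + α) ≤ ENNReal.ofReal (c₂ ^ p)) :
    IsBergmanInterpolating p α a := by
  obtain ⟨m, rfl⟩ : ∃ m, n = m + 1 := ⟨n - 1, by omega⟩
  have hp0 : 0 < p := by linarith
  have hq : 1 / q = 1 - 1 / p := by linarith
  have hq0 : 0 < q := by
    have : 1 / p < 1 := (div_lt_one hp0).2 hp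
    exact one_div_pos.1 (by linarith)
  have hqp : q * (p - 1) = p := by
    field_simp at hq
    linarith
  have hαp : -1 < α * p := by rwa [div_lt_iff₀ hp0] at hα
  obtain ⟨N, hN⟩ : ∃ N : ℝ, N = (m : ℝ) + 2 + α * p := ⟨_, rfl⟩
  have hN0 : 0 < N := by
    have : (0 : ℝ) ≤ m := m.cast_nonneg
    linarith
  intro v hv
  rw [MemWeightedLp] at hv
  have hs : ((m + 1 : ℕ) : ℝ) + 1 = m + 2 := by push_cast; ring
  have hsN : (((m + 1 : ℕ) : ℝ) + 1) / p + α = N / p := by rw [hs, hN]; field_simp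
  have htN : (((m + 1 : ℕ) : ℝ) + 1) / q + β = N - N / p := by
    rw [hs, hβ, ← add_div, ← hN, div_eq_mul_one_div, hq]; ring
  rw [hsN] at hv hK₁ hK₂
  rw [htN] at hK₁ hK₂
  -- As c₁c₂ < 1, either c₁ < 1 or c₂ < 1, hence one of c₁^q and c₂^p is below 1.
  obtain ⟨θ, hθ, hsep⟩ := exists_separation ha (by linarith : 0 < N / p + (N - N / p))
    (by positivity : 0 ≤ c₁ ^ q) (by positivity : 0 ≤ c₂ ^ p) (by
      rw [min_lt_iff]
      rcases lt_or_ge c₁ 1 with h | h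
      · exact Or.inl (Real.rpow_lt_one hc₁.le h hq0)
      · exact Or.inr (Real.rpow_lt_one hc₂.le (by nlinarith) hp0)) hK₁ hK₂
  have hrow := tsum_le_of_bergmanK_le hK₁
  have hcol := tsum_le_of_bergmanK_le hK₂
  rw [add_sub_cancel] at hrow
  rw [sub_add_cancel] at hcol
  set s := N / p with hs_def
  set t := N - s with ht_def
  have hδ : ∀ k, 0 < 1 - ‖a k‖ ^ 2 := fun k => one_sub_norm_sq_pos (ha k)
  -- The off-diagonal part of the interpolation system after weighting row k by (1-|a_k|²)^s; the
  -- diagonal is then exactly 1 because s + t = N.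
  let M : ℕ → ℕ → ℂ := fun k j => if j = k then 0 else
    (((1 - ‖a k‖ ^ 2) ^ s : ℝ) : ℂ) * (((1 - ‖a j‖ ^ 2) ^ t : ℝ) : ℂ) * bergmanKernel N (a j) (a k)
  have hMn : ∀ k j, j ≠ k → ‖M k j‖ =
      (1 - ‖a k‖ ^ 2) ^ s * (1 - ‖a j‖ ^ 2) ^ t / ‖1 - inner ℂ (a k) (a j)‖ ^ N := by
    intro k j hjk
    have hk := hδ k
    have hj := hδ j
    simp only [M, if_neg hjk]
    rw [norm_mul, norm_mul, Complex.norm_real, Complex.norm_real, norm_bergmanKernel,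
      Real.norm_of_nonneg (by positivity), Real.norm_of_nonneg (by positivity), ← div_eq_mul_inv,
      norm_one_sub_inner_comm]
  have hMr : ∀ k, ∑' j, ‖M k j‖ₑ ≤ ENNReal.ofReal (c₁ ^ q) := by
    intro k
    refine le_trans (ENNReal.tsum_le_tsum fun j => ?_) (hrow k)
    by_cases hjk : j = k
    · simp [M, hjk]
    · rw [Set.indicator_of_mem (show j ∈ {j | j ≠ k} from hjk), ← ofReal_norm, hMn k j hjk]
  have hMc : ∀ j, ∑' k, ‖M k j‖ₑ ≤ ENNReal.ofReal (c₂ ^ p) := by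
    intro j
    refine le_trans (ENNReal.tsum_le_tsum fun k => ?_) (hcol j)
    by_cases hkj : k = j
    · simp [M, hkj]
    · rw [Set.indicator_of_mem (show k ∈ {k | k ≠ j} from hkj), ← ofReal_norm,
        hMn k j (Ne.symm hkj), norm_one_sub_inner_comm, mul_comm]
  -- The relation q(p-1) = p turns the Schur constant into the p-th power of c₁c₂.
  have hcon : ENNReal.ofReal (c₁ ^ q) ^ (p - 1) * ENNReal.ofReal (c₂ ^ p) =
      ENNReal.ofReal ((c₁ * c₂) ^ p) := by
    rw [ENNReal.ofReal_rpow_of_pos (by positivity), ← Real.rpow_mul hc₁.le, hqp,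
      ← ENNReal.ofReal_mul (by positivity), Real.mul_rpow hc₁.le hc₂.le]
  obtain ⟨u, hu, hsol⟩ := exists_add_tsum_mul_eq hp (mul_pos hc₁ hc₂).le hc M
    (fun x => hcon ▸ ENNReal.tsum_tsum_mul_rpow_le hp hMr hMc x)
    (fun k => (((1 - ‖a k‖ ^ 2) ^ s : ℝ) : ℂ) * v k) (by
      rw [tsum_enorm_rpow_lt_top_iff _ hp0]
      refine hv.congr fun k => ?_
      have hk := hδ k
      rw [norm_mul, Complex.norm_real, Real.norm_of_nonneg (by positivity)])
  have hub : ∃ S, ∀ j, ‖u j‖ ≤ S := by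
    have hsu := (tsum_enorm_rpow_lt_top_iff u hp0).1 hu
    refine ⟨(∑' j, ‖u j‖ ^ p) ^ p⁻¹, fun j => ?_⟩
    have h := Real.rpow_le_rpow (by positivity)
      (hsu.le_tsum j fun i _ => Real.rpow_nonneg (norm_nonneg _) p) (inv_nonneg.2 hp0.le)
    rwa [← Real.rpow_mul (norm_nonneg _), mul_inv_cancel₀ hp0.ne', Real.rpow_one] at h
  -- The coefficients are absolutely summable because u is bounded and |1-⟨a_0,a_j⟩| ≤ 2, which
  -- makes (1-|a_j|²)^t at most a constant times the summable row 0 of M. The index j = 0 is left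
  -- out since that diagonal entry is zero.
  have hcs : Summable fun j => ‖u j * (((1 - ‖a j‖ ^ 2) ^ t : ℝ) : ℂ)‖ := by
    obtain ⟨S, hS⟩ := hub
    have hM0 : Summable fun j => ‖M 0 j‖ :=
      tsum_enorm_ne_top_iff_summable_norm.1 ((hMr 0).trans_lt ENNReal.ofReal_lt_top).ne
    refine Summable.of_norm_bounded_eventually_nat
      (hM0.mul_left (S * (2 ^ N / (1 - ‖a 0‖ ^ 2) ^ s))) ?_
    filter_upwards [Filter.eventually_ge_atTop 1] with j hj1
    have h0 := hδ 0
    have hj := hδ j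
    have hX := norm_one_sub_inner_pos (ha 0) (ha j)
    have hX2 : ‖1 - inner ℂ (a 0) (a j)‖ ≤ 2 := by
      have h1 : ‖a 0‖ < 1 := by simpa [unitBall] using ha 0
      have h2 : ‖a j‖ < 1 := by simpa [unitBall] using ha j
      have h3 := norm_sub_le (1 : ℂ) (inner ℂ (a 0) (a j))
      have h4 := norm_inner_le_norm (𝕜 := ℂ) (a 0) (a j)
      rw [norm_one] at h3
      nlinarith [norm_nonneg (a 0), norm_nonneg (a j)]
    have hXN : ‖1 - inner ℂ (a 0) (a j)‖ ^ N ≤ 2 ^ N := Real.rpow_le_rpow hX.le hX2 hN0.le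
    rw [norm_norm, norm_mul, Complex.norm_real, Real.norm_of_nonneg (by positivity),
      hMn 0 j (by omega), mul_assoc]
    refine mul_le_mul (hS j) ?_ (by positivity) ((norm_nonneg _).trans (hS j))
    rw [div_mul_div_comm, le_div_iff₀ (by positivity)]
    have : 0 ≤ (1 - ‖a 0‖ ^ 2) ^ s * (1 - ‖a j‖ ^ 2) ^ t := by positivity
    nlinarith
  refine ⟨_, memBergman_tsum_mul_bergmanKernel hp hαp hθ ha hsep hN hu hcs, fun k => ?_⟩
  have hk := hδ k
  have hks : (((1 - ‖a k‖ ^ 2) ^ s : ℝ) : ℂ) ≠ 0 := by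
    exact_mod_cast (Real.rpow_pos_of_pos hk s).ne'
  refine mul_left_cancel₀ hks ?_
  -- Isolating the term j = k leaves u_k plus the k-th coordinate of Mu.
  rw [← hsol k, ← tsum_mul_left,
    ((summable_mul_bergmanKernel hN0 ha hcs (ha k)).mul_left _).tsum_eq_add_tsum_ite k]
  congr 1
  · rw [bergmanKernel_self N (ha k), mul_comm (u k), mul_right_comm, ← mul_assoc,
      ← Complex.ofReal_mul, ← Complex.ofReal_mul, ← Real.rpow_add hk, ← Real.rpow_add hk]
    have : s + (N - N / p + -N) = 0 := by rw [hs_def]; ring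
    rw [this, Real.rpow_zero, Complex.ofReal_one, one_mul]
  · refine tsum_congr fun j => ?_
    by_cases hjk : j = k
    · simp [M, hjk]
    · simp only [M, if_neg hjk]
      ring
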